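/- Let $X=(X_1,\dots,X_d)\in\mathbb R^d$ have response pattern $R\in\{0,1\}^d$ ($R_j=1$ iff $X_j$ is observed), $\bar R=1-R$, so that the observed data are $(R,X_R)$ with $X_R=(X_j:R_j=1)$. Let $G$ be an undirected graph on $\{1,\dots,d\}$. For a vertex set $s$ (identified with its indicator vector) let $N_G(s)$ be the set of vertices outside $s$ adjacent to $s$, and $\bar N_G(s)=s\cup N_G(s)$; $R\ge S$ means $R_j=1$ for all $j\in S$. Consider the nonparametric Markov missing graph model: all laws of $(X,R)$ such that, for every pattern $r$ with connected components $s_1,\dots,s_K$ of $\bar r$ in $G$, $$p(x_{\bar r}\mid x_r,R=r)=\prod_{k=1}^K p(x_{s_k}\mid x_{N_G(s_k)},R=r),\qquad p(x_{s_k}\mid x_{N_G(s_k)},R=r)=p(x_{s_k}\mid x_{N_G(s_k)},R\ge\bar N_G(s_k)),$$ where, for the second identity to make sense, the law of $X_{N_G(s_k)}$ on $\{R=r\}$ is absolutely continuous with respect to its law on $\{R\ge\bar N_G(s_k)\}$. (Here $p$ denotes conditional distributions.) Fix a target coordinate, say $X_1$. For a pattern $r$ with $r_1=0$ let $\psi(\bar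 r)$ be the connected component of $\bar r$ in $G$ that contains vertex $1$; if $r_1=1$, the event below does not occur. Let $s$ be a connected vertex set containing $1$, let $P$ be a law in the model with $\mathbb E|X_1|I(\psi(\bar R)=s)<\infty$, and put $\mu_s=\mathbb E[X_1I(\psi(\bar R)=s)]$, $$m_s(x_{N_G(s)})=\int x_1\,p(x_1\mid x_{N_G(s)},R\ge\bar N_G(s))\,dx_1,\qquad O_s(x_{N_G(s)})=\frac{P(\psi(\bar R)=s\mid x_{N_G(s)})}{P(R\ge\bar N_G(s)\mid x_{N_G(s)})},$$ $$\mathrm{EIF}_s=X_1O_s(X_{N_G(s)})I(R\ge\bar N_G(s))+m_s(X_{N_G(s)})\bigl(I(\psi(\bar R)=s)-I(R\ge\bar N_G(s))O_s(X_{N_G(s)})\bigr)-\mu_s .$$ A submodel through $P$ with score $g$ (a bounded function of the observed data with mean zero under $P$) is a family $(P_\epsilon)$ with $P_0=P$ which for all $\epsilon$ near $0$ lies in the model and has observed-data law $(1+\epsilon g)$ times that of $P$; the tangent space is the closed linear span of all scores in $L^2$ of the observed-data law. Then: 1. $\mathrm{EIF}_s$ is a function of the observed data, is integrable, and has mean zero.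 2. Along every submodel $(P_\epsilon)$ with score $g$, the variable $X_1I(\psi(\bar R)=s)$ is integrable under $P_\epsilon$ for $\epsilon$ near $0$, and $\frac{d}{d\epsilon}\mu_s(P_\epsilon)\big|_{\epsilon=0}=\mathbb E[\mathrm{EIF}_s\,g]$. 3. $\mathrm{EIF}_s$ is the efficient influence function of $\mu_s$ at $P$: a function $\varphi$ of the observed data is an efficient influence function (that is, $\varphi$ is square integrable, lies in the tangent space, and satisfies $\frac{d}{d\epsilon}\mu_s(P_\epsilon)|_{\epsilon=0}=\mathbb E[\varphi g]$ for every submodel) if and only if $\mathrm{EIF}_s$ is square integrable and $\varphi=\mathrm{EIF}_s$ almost surely. -/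

import Mathlib

open MeasureTheory ProbabilityTheory Filter Topology

namespace MMG

/-- A response pattern `r ∈ {0,1}^d`: `r j = true` means that the `j`-th variable is observed. -/
abbrev Pattern (d : ℕ) : Type := Fin d → Bool

/-- The sample space of the full data `(X, R)`. -/
abbrev FullData (d : ℕ) : Type := (Fin d → ℝ) × Pattern d

/-- The reversed pattern `r̄ = 1 - r`. -/
def revPattern {d : ℕ} (r : Pattern d) : Pattern d := fun j => !(r j)

/-- The vertex set `V_r = {j : r_j = 1}` of a binary vector; subsets of the vertex set and binary
vectors are identified through it. -/
def ones {d : ℕ} (r : Pattern d) : Finset (Fin d) := Finset.univ.filter fun j => r j = true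

open Classical in
/-- `N_G(s)`: the vertices outside `s` that are adjacent to some vertex of `s`. -/
noncomputable def boundary {d : ℕ} (G : SimpleGraph (Fin d)) (s : Finset (Fin d)) :
    Finset (Fin d) :=
  Finset.univ.filter fun v => v ∉ s ∧ ∃ u ∈ s, G.Adj u v

/-- `N̄_G(s) = s ∪ N_G(s)`. -/
noncomputable def closedNbhd {d : ℕ} (G : SimpleGraph (Fin d)) (s : Finset (Fin d)) :
    Finset (Fin d) :=
  s ∪ boundary G s

open Classical in
/-- The connected component containing `a` of the subgraph of `G` induced on `A`
(it is empty if `a ∉ A`). -/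
noncomputable def component {d : ℕ} (G : SimpleGraph (Fin d)) (A : Finset (Fin d)) (a : Fin d) :
    Finset (Fin d) :=
  Finset.univ.filter fun v => ∃ (ha : a ∈ A) (hv : v ∈ A),
    (G.induce (A : Set (Fin d))).Reachable ⟨a, ha⟩ ⟨v, hv⟩

open Classical in
/-- All connected components of the subgraph of `G` induced on `A`. -/
noncomputable def components {d : ℕ} (G : SimpleGraph (Fin d)) (A : Finset (Fin d)) :
    Finset (Finset (Fin d)) :=
  A.image (component G A)

/-- `ψ(r)`: the connected component of `r` that contains the target variable `a`. -/
noncomputable def psi {d : ℕ} (G : SimpleGraph (Fin d)) (a : Fin d) (r : Pattern d) :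
    Finset (Fin d) :=
  component G (ones r) a

/-- The subvector `X_S`. -/
def subvec {d : ℕ} (S : Finset (Fin d)) (ω : FullData d) : S → ℝ := fun j => ω.1 j

/-- The event `{R = r}`. -/
def patternEq {d : ℕ} (r : Pattern d) : Set (FullData d) := {ω | ω.2 = r}

/-- The patterns `r ≥ S`, i.e. `r_j = 1` for all `j ∈ S`. -/
def patternsGE {d : ℕ} (S : Finset (Fin d)) : Set (Pattern d) := {r | ∀ j ∈ S, r j = true}

/-- The event `{R ≥ S}`. -/
def allObserved {d : ℕ} (S : Finset (Fin d)) : Set (FullData d) := {ω | ω.2 ∈ patternsGE S}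

/-- The patterns `r` with `ψ(r̄) = s`. -/
def psiPatterns {d : ℕ} (G : SimpleGraph (Fin d)) (a : Fin d) (s : Finset (Fin d)) :
    Set (Pattern d) :=
  {r | psi G a (revPattern r) = s}

/-- The event `{ψ(R̄) = s}`. -/
def psiEvent {d : ℕ} (G : SimpleGraph (Fin d)) (a : Fin d) (s : Finset (Fin d)) :
    Set (FullData d) :=
  {ω | ω.2 ∈ psiPatterns G a s}

/-- The Markov property
`p(x_{r̄} | x_r, R = r) = ∏_k p(x_{s_k} | x_{N_G(s_k)}, R = r)`, with `s_1, …, s_K` the connected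
components of `r̄`, for conditional laws (no dominating measure is needed): the two conditional
laws of `X_{r̄}` agree on all products `∏_k B_k` of events about the `X_{s_k}`, which generate.
Restricting to `{R = r}` instead of conditioning on it only changes the total mass, and so
does not change the conditional distributions. -/
def MarkovProperty {d : ℕ} (G : SimpleGraph (Fin d)) (P : ProbabilityMeasure (FullData d)) :
    Prop :=
  ∀ (r : Pattern d) (B : ∀ s : Finset (Fin d), Set (s → ℝ)), (∀ s, MeasurableSet (B s)) →
    ∀ᵐ ω ∂((P : Measure (FullData d)).restrict (patternEq r)),
      condDistrib (fun ω' : FullData d => ω'.1) (subvec (ones r))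
          ((P : Measure (FullData d)).restrict (patternEq r)) (subvec (ones r) ω)
          {y | ∀ s ∈ components G (ones (revPattern r)), (fun j : s => y j) ∈ B s}
        = ∏ s ∈ components G (ones (revPattern r)),
            condDistrib (subvec s) (subvec (boundary G s))
              ((P : Measure (FullData d)).restrict (patternEq r)) (subvec (boundary G s) ω) (B s)

/-- The nonparametric principle of available information
`p(x_s | x_{N_G(s)}, R = r) = p(x_s | x_{N_G(s)}, R ≥ N̄_G(s))`
for every connected component `s` of `r̄`. The first clause (overlap) says that the right-hand side
is defined wherever the left-hand side is. -/
def AvailableInformation {d : ℕ} (G : SimpleGraph (Fin d))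
    (P : ProbabilityMeasure (FullData d)) : Prop :=
  ∀ (r : Pattern d), ∀ s ∈ components G (ones (revPattern r)),
    ((P : Measure (FullData d)).restrict (patternEq r)).map (subvec (boundary G s)) ≪
        ((P : Measure (FullData d)).restrict (allObserved (closedNbhd G s))).map
          (subvec (boundary G s)) ∧
    condDistrib (subvec s) (subvec (boundary G s))
        ((P : Measure (FullData d)).restrict (patternEq r))
      =ᵐ[((P : Measure (FullData d)).restrict (patternEq r)).map (subvec (boundary G s))]
    condDistrib (subvec s) (subvec (boundary G s))
        ((P : Measure (FullData d)).restrict (allObserved (closedNbhd G s)))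

/-- The nonparametric Markov missing graph model: all full-data laws with the Markov property
and the principle of available information for the graph `G`. -/
def model {d : ℕ} (G : SimpleGraph (Fin d)) : Set (ProbabilityMeasure (FullData d)) :=
  {P | MarkovProperty G P ∧ AvailableInformation G P}

/-- The observed data `(X_R, R)`. Missing entries are recorded as `0`; since the pattern is kept,
the pair carries exactly the information of `(R, X_R)`. -/
def observe {d : ℕ} (ω : FullData d) : FullData d :=
  (fun j => if ω.2 j = true then ω.1 j else 0, ω.2)

/-- The law of the observed data. -/
noncomputable def obsLaw {d : ℕ} (P : ProbabilityMeasure (FullData d)) : Measure (FullData d) :=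
  (P : Measure (FullData d)).map observe

/-- `t ↦ Q t` is a one-dimensional submodel of `M` through `P` whose observed-data laws are the
perturbations `p_t = p_0 (1 + t g)`; its score at `t = 0` is `g`. (Nonnegativity of `1 + t g`
for all `t` near `0`, on both sides, forces `g` to be bounded.) -/
structure IsSubmodel {d : ℕ} (M : Set (ProbabilityMeasure (FullData d)))
    (P : ProbabilityMeasure (FullData d)) (g : FullData d → ℝ)
    (Q : ℝ → ProbabilityMeasure (FullData d)) : Prop where
  measurable_score : Measurable g
  bounded_score : ∃ C : ℝ, ∀ o, |g o| ≤ C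
  score_mean : ∫ o, g o ∂(obsLaw P) = 0
  base : Q 0 = P
  mem_model : ∀ᶠ t in 𝓝 (0 : ℝ), Q t ∈ M
  obsLaw_eq : ∀ᶠ t in 𝓝 (0 : ℝ),
    obsLaw (Q t) = (obsLaw P).withDensity fun o => ENNReal.ofReal (1 + t * g o)

/-- The tangent space of `M` at `P`: the closed linear span in `L²` of the observed-data law
of the scores of the submodels through `P`. -/
noncomputable def tangentSpace {d : ℕ} (M : Set (ProbabilityMeasure (FullData d)))
    (P : ProbabilityMeasure (FullData d)) : Submodule ℝ (Lp ℝ 2 (obsLaw P)) :=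
  (Submodule.span ℝ {h : Lp ℝ 2 (obsLaw P) |
    ∃ g Q, IsSubmodel M P g Q ∧ h =ᵐ[obsLaw P] g}).topologicalClosure

/-- `φ`, a function of the observed data, is an efficient influence function (canonical gradient)
of the parameter `θ` at `P` in the model `M`: it is square integrable, it lies in the tangent space,
and the derivative of `θ` along every submodel is the inner product of `φ` with the score. -/
structure IsEfficientInfluenceFunction {d : ℕ} (M : Set (ProbabilityMeasure (FullData d)))
    (θ : ProbabilityMeasure (FullData d) → ℝ) (P : ProbabilityMeasure (FullData d))
    (φ : FullData d → ℝ) : Prop where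
  memLp : MemLp φ 2 (obsLaw P)
  mem_tangentSpace : memLp.toLp φ ∈ tangentSpace M P
  hasDerivAt : ∀ g Q, IsSubmodel M P g Q →
    HasDerivAt (fun t => θ (Q t)) (∫ o, φ o * g o ∂(obsLaw P)) 0

/-- The random variable `X_a · I(ψ(R̄) = s)`. -/
noncomputable def targetVar {d : ℕ} (G : SimpleGraph (Fin d)) (a : Fin d) (s : Finset (Fin d)) :
    FullData d → ℝ :=
  (psiEvent G a s).indicator fun ω => ω.1 a

/-- The parameter `μ_s = E[X_a · I(ψ(R̄) = s)]`. -/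
noncomputable def mu {d : ℕ} (G : SimpleGraph (Fin d)) (a : Fin d) (s : Finset (Fin d))
    (P : ProbabilityMeasure (FullData d)) : ℝ :=
  ∫ ω, targetVar G a s ω ∂(P : Measure (FullData d))

/-- The regression function
`m_s(x_{N_G(s)}) = ∫ x_a p(x_a | x_{N_G(s)}, R ≥ N̄_G(s)) dx_a`. -/
noncomputable def regression {d : ℕ} (G : SimpleGraph (Fin d)) (a : Fin d) (s : Finset (Fin d))
    (P : ProbabilityMeasure (FullData d)) (z : boundary G s → ℝ) : ℝ :=
  ∫ y, y ∂(condDistrib (fun ω : FullData d => ω.1 a) (subvec (boundary G s))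
    ((P : Measure (FullData d)).restrict (allObserved (closedNbhd G s))) z)

/-- The odds
`O_s(x_{N_G(s)}) = P(ψ(R̄) = s | x_{N_G(s)}) / P(R ≥ N̄_G(s) | x_{N_G(s)})`. -/
noncomputable def odds {d : ℕ} (G : SimpleGraph (Fin d)) (a : Fin d) (s : Finset (Fin d))
    (P : ProbabilityMeasure (FullData d)) (z : boundary G s → ℝ) : ℝ :=
  (condDistrib (fun ω : FullData d => ω.2) (subvec (boundary G s))
      (P : Measure (FullData d)) z).real (psiPatterns G a s) /
    (condDistrib (fun ω : FullData d => ω.2) (subvec (boundary G s))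
      (P : Measure (FullData d)) z).real (patternsGE (closedNbhd G s))

/-- The linear form
`X_a O_s(X_N) I(R ≥ N̄) + m_s(X_N) (I(ψ(R̄) = s) - I(R ≥ N̄) O_s(X_N))`, where `N = N_G(s)`. -/
noncomputable def leif {d : ℕ} (G : SimpleGraph (Fin d)) (a : Fin d) (s : Finset (Fin d))
    (P : ProbabilityMeasure (FullData d)) (ω : FullData d) : ℝ :=
  ω.1 a * odds G a s P (subvec (boundary G s) ω) *
      (allObserved (closedNbhd G s)).indicator (fun _ => (1 : ℝ)) ω +
    regression G a s P (subvec (boundary G s) ω) *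
      ((psiEvent G a s).indicator (fun _ => (1 : ℝ)) ω -
        (allObserved (closedNbhd G s)).indicator (fun _ => (1 : ℝ)) ω *
          odds G a s P (subvec (boundary G s) ω))

/-- The linear form centred at the parameter. -/
noncomputable def eif {d : ℕ} (G : SimpleGraph (Fin d)) (a : Fin d) (s : Finset (Fin d))
    (P : ProbabilityMeasure (FullData d)) (ω : FullData d) : ℝ :=
  leif G a s P ω - mu G a s P

end MMG

/-!
The efficient influence function of `μ_s` rests on two facts about the Markov missing graph model.

The parameter is identified by reweighting. On `{ψ(R̄) = s}` the conditional law of `X_s` given the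
boundary `X_N`, `N = N_G(s)`, equals the one on `{R ≥ N̄_G(s)}`, by the principle of available
information applied to each pattern and summed over the patterns. Overlap makes the odds `O_s` the
density of the law of `X_N` on the first event with respect to its law on the second one. Hence the
law of `(X_N, X_a)` on `{ψ(R̄) = s}` is its law on `{R ≥ N̄_G(s)}` weighted by `O_s`
(`map_psiEvent_eq_map_withDensity`); this gives integrability and mean zero. Differentiability needs
no differentiation under the integral sign: for two laws of the model, the error of the first-order
expansion is an integral of `X_a - m_s` times the change of the odds, and conditioning on `X_N`
shows that only the part of the second law proportional to the score contributes. Along a submodel the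
odds are Lipschitz relative to their value at the base point (`abs_odds_sub_le`), because the
perturbed laws of `X_N` on both events lie between multiples of the unperturbed ones. So the
remainder is quadratic (`abs_mu_sub_le`).

The model is nonparametric for the observed data. Given an observed-data law with overlap, draw
every component of the missing variables, independently, from the conditional law given its boundary on
the event that the component and its boundary are observed. The result obeys both restrictions of
the model and has the given observed-data law (`exists_mem_model_obsLaw_eq`). Bounded perturbations
keep overlap, so every bounded mean-zero function is a score (`exists_isSubmodel`), and the tangent
space is the whole space of mean-zero square-integrable functions (`mem_tangentSpace_iff`). The
difference of two mean-zero gradients is then orthogonal to all bounded mean-zero functions, so it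
vanishes almost surely.
-/

namespace MMG

open scoped ENNReal

/-! ### Connected components and their boundaries -/

section Graph

variable {d : ℕ} {G : SimpleGraph (Fin d)}

theorem mem_component {A : Finset (Fin d)} {a v : Fin d} :
    v ∈ component G A a ↔ ∃ (ha : a ∈ A) (hv : v ∈ A),
      (G.induce (A : Set (Fin d))).Reachable ⟨a, ha⟩ ⟨v, hv⟩ := by
  classical
  simp only [component, Finset.mem_filter, Finset.mem_univ, true_and]

theorem mem_boundary {s : Finset (Fin d)} {v : Fin d} :
    v ∈ boundary G s ↔ v ∉ s ∧ ∃ u ∈ s, G.Adj u v := by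
  classical
  simp [boundary]

theorem mem_components {A s : Finset (Fin d)} :
    s ∈ components G A ↔ ∃ a ∈ A, component G A a = s := by
  classical
  simp [components]

theorem subset_of_mem_components {A s : Finset (Fin d)} (hs : s ∈ components G A) : s ⊆ A := by
  obtain ⟨a, -, rfl⟩ := mem_components.1 hs
  intro v hv
  exact (mem_component.1 hv).2.1

theorem component_eq_of_mem {A : Finset (Fin d)} {a v : Fin d} (hv : v ∈ component G A a) :
    component G A v = component G A a := by
  obtain ⟨ha, hvA, h⟩ := mem_component.1 hv
  ext w
  simp only [mem_component]
  exact ⟨fun ⟨_, hw, h'⟩ => ⟨ha, hw, h.trans h'⟩, fun ⟨_, hw, h'⟩ => ⟨hvA, hw, h.symm.trans h'⟩⟩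

theorem disjoint_of_mem_components {A s t : Finset (Fin d)} (hs : s ∈ components G A)
    (ht : t ∈ components G A) (hst : s ≠ t) : Disjoint s t := by
  obtain ⟨a, -, rfl⟩ := mem_components.1 hs
  obtain ⟨b, -, rfl⟩ := mem_components.1 ht
  rw [Finset.disjoint_left]
  intro v hv hv'
  exact hst ((component_eq_of_mem hv).symm.trans (component_eq_of_mem hv'))

/-- The neighbours of a component of `A` lie outside `A`. -/
theorem notMem_of_mem_boundary {A s : Finset (Fin d)} (hs : s ∈ components G A) {v : Fin d}
    (hv : v ∈ boundary G s) : v ∉ A := by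
  obtain ⟨a, -, rfl⟩ := mem_components.1 hs
  obtain ⟨hvs, u, hu, huv⟩ := mem_boundary.1 hv
  obtain ⟨ha, huA, h⟩ := mem_component.1 hu
  intro hvA
  refine hvs (mem_component.2 ⟨ha, hvA, h.trans (SimpleGraph.Adj.reachable ?_)⟩)
  simpa using huv

theorem mem_ones {r : Pattern d} {j : Fin d} : j ∈ ones r ↔ r j = true := by
  simp [ones]

theorem mem_ones_revPattern {r : Pattern d} {j : Fin d} :
    j ∈ ones (revPattern r) ↔ r j = false := by
  simp [ones, revPattern]

theorem eq_false_of_mem_components {r : Pattern d} {s : Finset (Fin d)}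
    (hs : s ∈ components G (ones (revPattern r))) {j : Fin d} (hj : j ∈ s) : r j = false :=
  mem_ones_revPattern.1 (subset_of_mem_components hs hj)

/-- The boundary of a component of the missing variables is observed. -/
theorem eq_true_of_mem_boundary {r : Pattern d} {s : Finset (Fin d)}
    (hs : s ∈ components G (ones (revPattern r))) {j : Fin d} (hj : j ∈ boundary G s) :
    r j = true := by
  have := notMem_of_mem_boundary hs hj
  rw [mem_ones_revPattern] at this
  simpa using this

theorem mem_components_of_psi_eq {r : Pattern d} {a : Fin d} {s : Finset (Fin d)} (has : a ∈ s)
    (h : r ∈ psiPatterns G a s) : s ∈ components G (ones (revPattern r)) := by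
  have h' : component G (ones (revPattern r)) a = s := h
  refine mem_components.2 ⟨a, ?_, h'⟩
  rw [← h'] at has
  exact (mem_component.1 has).1

end Graph

/-! ### Functions of the observed data -/

section Observe

variable {d : ℕ} {G : SimpleGraph (Fin d)}

theorem measurable_subvec (S : Finset (Fin d)) : Measurable (subvec (d := d) S) := by
  unfold subvec
  fun_prop

theorem measurableSet_pattern_preimage (T : Set (Pattern d)) :
    MeasurableSet {ω : FullData d | ω.2 ∈ T} :=
  measurable_snd (MeasurableSet.of_discrete (s := T))

theorem measurableSet_patternEq (r : Pattern d) : MeasurableSet (patternEq (d := d) r) :=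
  measurableSet_pattern_preimage {r}

theorem measurableSet_allObserved (S : Finset (Fin d)) :
    MeasurableSet (allObserved (d := d) S) :=
  measurableSet_pattern_preimage _

theorem measurableSet_psiEvent (a : Fin d) (s : Finset (Fin d)) :
    MeasurableSet (psiEvent G a s) :=
  measurableSet_pattern_preimage _

theorem measurable_observe : Measurable (observe (d := d)) := by
  refine Measurable.prodMk (measurable_pi_lambda _ fun j => ?_) measurable_snd
  refine Measurable.ite ?_ (by fun_prop) measurable_const
  exact measurableSet_pattern_preimage {r | r j = true}

theorem observe_snd (ω : FullData d) : (observe ω).2 = ω.2 := rfl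

theorem observe_fst_of_eq_true {ω : FullData d} {j : Fin d} (h : ω.2 j = true) :
    (observe ω).1 j = ω.1 j := by
  simp [observe, h]

theorem subvec_observe {S : Finset (Fin d)} {ω : FullData d} (h : ∀ j ∈ S, ω.2 j = true) :
    subvec S (observe ω) = subvec S ω := by
  ext j
  exact observe_fst_of_eq_true (h j j.2)

theorem subvec_boundary_observe_of_allObserved {s : Finset (Fin d)} {ω : FullData d}
    (h : ω ∈ allObserved (closedNbhd G s)) :
    subvec (boundary G s) (observe ω) = subvec (boundary G s) ω :=
  subvec_observe fun j hj => h j (Finset.mem_union_right _ hj)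

theorem subvec_observe_of_allObserved {s : Finset (Fin d)} {ω : FullData d}
    (h : ω ∈ allObserved (closedNbhd G s)) :
    subvec s (observe ω) = subvec s ω :=
  subvec_observe fun j hj => h j (Finset.mem_union_left _ hj)

theorem subvec_boundary_observe_of_components {r : Pattern d} {s : Finset (Fin d)}
    (hs : s ∈ components G (ones (revPattern r))) {ω : FullData d} (h : ω ∈ patternEq r) :
    subvec (boundary G s) (observe ω) = subvec (boundary G s) ω :=
  subvec_observe fun j hj => by
    rw [show ω.2 = r from h]
    exact eq_true_of_mem_boundary hs hj

theorem subvec_boundary_observe_of_psiEvent {a : Fin d} {s : Finset (Fin d)} (has : a ∈ s)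
    {ω : FullData d} (h : ω ∈ psiEvent G a s) :
    subvec (boundary G s) (observe ω) = subvec (boundary G s) ω :=
  subvec_boundary_observe_of_components (mem_components_of_psi_eq has h) rfl

instance isProbabilityMeasure_obsLaw (P : ProbabilityMeasure (FullData d)) :
    IsProbabilityMeasure (obsLaw P) :=
  Measure.isProbabilityMeasure_map measurable_observe.aemeasurable

/-- On an event about the pattern, a statistic that is determined by the observed data has the same
law under the observed-data law as under the full-data law. -/
theorem map_restrict_obsLaw {β : Type*} [MeasurableSpace β] (P : ProbabilityMeasure (FullData d))
    {T : Set (Pattern d)} {f : FullData d → β} (hf : Measurable f)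
    (h : ∀ ω : FullData d, ω.2 ∈ T → f (observe ω) = f ω) :
    ((obsLaw P).restrict {ω | ω.2 ∈ T}).map f =
      ((P : Measure (FullData d)).restrict {ω | ω.2 ∈ T}).map f := by
  have hT := measurableSet_pattern_preimage T
  rw [obsLaw, Measure.restrict_map measurable_observe hT, Measure.map_map hf measurable_observe]
  refine Measure.map_congr ?_
  change ∀ᵐ ω ∂((P : Measure (FullData d)).restrict {ω | ω.2 ∈ T}), _
  filter_upwards [ae_restrict_mem hT] with ω hω using h ω hω

theorem integral_obsLaw (P : ProbabilityMeasure (FullData d)) {f : FullData d → ℝ}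
    (hf : Measurable f) (h : ∀ ω, f (observe ω) = f ω) :
    ∫ o, f o ∂(obsLaw P) = ∫ ω, f ω ∂(P : Measure (FullData d)) := by
  rw [obsLaw, integral_map measurable_observe.aemeasurable hf.aestronglyMeasurable]
  simp_rw [h]

theorem integrable_obsLaw_iff (P : ProbabilityMeasure (FullData d)) {f : FullData d → ℝ}
    (hf : Measurable f) (h : ∀ ω, f (observe ω) = f ω) :
    Integrable f (obsLaw P) ↔ Integrable f (P : Measure (FullData d)) := by
  rw [obsLaw, integrable_map_measure hf.aestronglyMeasurable measurable_observe.aemeasurable]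
  have : f ∘ observe = f := funext h
  rw [this]

theorem indicator_pattern_observe (T : Set (Pattern d)) (ω : FullData d) :
    {ω : FullData d | ω.2 ∈ T}.indicator (fun _ => (1 : ℝ)) (observe ω) =
      {ω : FullData d | ω.2 ∈ T}.indicator (fun _ => (1 : ℝ)) ω := rfl

/-- The influence function depends on the full data through the observed data only. -/
theorem eif_observe {a : Fin d} {s : Finset (Fin d)} (has : a ∈ s)
    (P : ProbabilityMeasure (FullData d)) (ω : FullData d) :
    eif G a s P (observe ω) = eif G a s P ω := by
  have h1 : (allObserved (closedNbhd G s)).indicator (fun _ => (1 : ℝ)) (observe ω) =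
      (allObserved (closedNbhd G s)).indicator (fun _ => (1 : ℝ)) ω :=
    indicator_pattern_observe _ ω
  have h2 : (psiEvent G a s).indicator (fun _ => (1 : ℝ)) (observe ω) =
      (psiEvent G a s).indicator (fun _ => (1 : ℝ)) ω :=
    indicator_pattern_observe _ ω
  unfold eif leif
  rw [h1, h2]
  by_cases hE : ω ∈ allObserved (closedNbhd G s)
  · rw [subvec_boundary_observe_of_allObserved hE,
      observe_fst_of_eq_true (hE a (Finset.mem_union_left _ has))]
  · by_cases hF : ω ∈ psiEvent G a s
    · simp [hE, hF, subvec_boundary_observe_of_psiEvent has hF]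
    · simp [hE, hF]

end Observe

/-! ### Conditional laws and odds -/

section General

variable {Ω β γ : Type*} [MeasurableSpace Ω] [MeasurableSpace β] [MeasurableSpace γ]

theorem map_withDensity_comp {μ : Measure Ω} {g : Ω → β} (hg : Measurable g) {f : β → ℝ≥0∞}
    (hf : Measurable f) : (μ.withDensity fun ω => f (g ω)).map g = (μ.map g).withDensity f := by
  ext t ht
  rw [Measure.map_apply hg ht, withDensity_apply _ (hg ht), withDensity_apply _ ht,
    setLIntegral_map ht hf hg]

theorem withDensity_compProd_left {ν : Measure β} [SFinite ν] {κ : Kernel β γ} [IsSFiniteKernel κ]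
    {f : β → ℝ≥0∞} (hf : Measurable f) :
    (ν.withDensity f) ⊗ₘ κ = (ν ⊗ₘ κ).withDensity fun p => f p.1 := by
  ext t ht
  rw [Measure.compProd_apply ht, withDensity_apply _ ht,
    lintegral_withDensity_eq_lintegral_mul _ hf (Kernel.measurable_kernel_prodMk_left ht),
    ← lintegral_indicator ht,
    Measure.lintegral_compProd (f := t.indicator fun p : β × γ => f p.1)
      ((hf.comp measurable_fst).indicator ht)]
  refine lintegral_congr fun z => ?_
  have : (fun y => t.indicator (fun p : β × γ => f p.1) (z, y)) =
      (Prod.mk z ⁻¹' t).indicator fun _ => f z := by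
    ext y
    by_cases h : (z, y) ∈ t <;> simp [h]
  rw [this, lintegral_indicator (measurable_prodMk_left ht)]
  simp

theorem map_restrict_preimage_eq_withDensity [StandardBorelSpace γ] [Nonempty γ] {μ : Measure Ω}
    [IsFiniteMeasure μ] {Z : Ω → β} {R : Ω → γ} (hZ : Measurable Z) (hR : Measurable R)
    {A : Set γ} (hA : MeasurableSet A) :
    (μ.restrict (R ⁻¹' A)).map Z = (μ.map Z).withDensity fun z => condDistrib R Z μ z A := by
  ext t ht
  rw [Measure.map_apply hZ ht, Measure.restrict_apply (hZ ht), withDensity_apply _ ht,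
    setLIntegral_map ht (Kernel.measurable_coe _ hA) hZ,
    setLIntegral_preimage_condDistrib hZ hR.aemeasurable hA ht]

/-- The ratio of the conditional probabilities of two events given `Z` is the density of the law of
`Z` on the first event with respect to its law on the second one. -/
theorem map_restrict_eq_withDensity_odds [StandardBorelSpace γ] [Nonempty γ] {μ : Measure Ω}
    [IsFiniteMeasure μ] {Z : Ω → β} {R : Ω → γ} (hZ : Measurable Z) (hR : Measurable R)
    {A B : Set γ} (hA : MeasurableSet A) (hB : MeasurableSet B)
    (hac : (μ.restrict (R ⁻¹' A)).map Z ≪ (μ.restrict (R ⁻¹' B)).map Z) :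
    (μ.restrict (R ⁻¹' A)).map Z = ((μ.restrict (R ⁻¹' B)).map Z).withDensity fun z =>
      ENNReal.ofReal ((condDistrib R Z μ z).real A / (condDistrib R Z μ z).real B) := by
  have mA := Kernel.measurable_coe (condDistrib R Z μ) hA
  have mB := Kernel.measurable_coe (condDistrib R Z μ) hB
  rw [map_restrict_preimage_eq_withDensity hZ hR hA, map_restrict_preimage_eq_withDensity hZ hR hB]
    at hac
  rw [map_restrict_preimage_eq_withDensity hZ hR hA, map_restrict_preimage_eq_withDensity hZ hR hB,
    ← withDensity_mul _ mB (by unfold Measure.real; fun_prop)]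
  -- where the denominator vanishes, so does the numerator, by absolute continuity
  have h0 : ∀ᵐ z ∂(μ.map Z), condDistrib R Z μ z B = 0 → condDistrib R Z μ z A = 0 := by
    have hS : MeasurableSet {z | condDistrib R Z μ z B = 0} := mB (measurableSet_singleton 0)
    have h1 : ((μ.map Z).withDensity fun z => condDistrib R Z μ z B)
        {z | condDistrib R Z μ z B = 0} = 0 := by
      rw [withDensity_apply _ hS, lintegral_eq_zero_iff mB]
      filter_upwards [ae_restrict_mem hS] with z hz using hz
    have h2 := hac h1
    rw [withDensity_apply _ hS, lintegral_eq_zero_iff mA] at h2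
    exact (ae_restrict_iff' hS).1 h2
  refine withDensity_congr_ae ?_
  filter_upwards [h0] with z hz
  simp only [Pi.mul_apply]
  by_cases hB0 : condDistrib R Z μ z B = 0
  · simp [hB0, hz hB0]
  · have hB' : 0 < (condDistrib R Z μ z).real B :=
      ENNReal.toReal_pos hB0 (measure_ne_top _ _)
    rw [ENNReal.ofReal_div_of_pos hB', ofReal_measureReal, ofReal_measureReal,
      ENNReal.mul_div_cancel hB0 (measure_ne_top _ _)]

end General

section Model

variable {d : ℕ} {G : SimpleGraph (Fin d)} {a : Fin d} {s : Finset (Fin d)}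

theorem measurable_odds (P : ProbabilityMeasure (FullData d)) : Measurable (odds G a s P) := by
  have h : ∀ T : Set (Pattern d), Measurable fun z =>
      (condDistrib (fun ω : FullData d => ω.2) (subvec (boundary G s))
        (P : Measure (FullData d)) z).real T := fun T =>
    (Kernel.measurable_coe _ (MeasurableSet.of_discrete (s := T))).ennreal_toReal
  exact (h _).div (h _)

theorem odds_nonneg (P : ProbabilityMeasure (FullData d)) (z : boundary G s → ℝ) :
    0 ≤ odds G a s P z :=
  div_nonneg measureReal_nonneg measureReal_nonneg

theorem measurable_regression (P : ProbabilityMeasure (FullData d)) :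
    Measurable (regression G a s P) := by
  unfold regression
  exact (StronglyMeasurable.integral_kernel_prod_right'
    (f := fun p : (boundary G s → ℝ) × ℝ => p.2) measurable_snd.stronglyMeasurable).measurable

theorem measurable_leif (P : ProbabilityMeasure (FullData d)) : Measurable (leif G a s P) := by
  have h1 := (measurable_odds (G := G) (a := a) (s := s) P).comp (measurable_subvec (boundary G s))
  have h2 := (measurable_regression (G := G) (a := a) (s := s) P).comp
    (measurable_subvec (boundary G s))
  have h3 : Measurable ((allObserved (d := d) (closedNbhd G s)).indicator fun _ => (1 : ℝ)) :=
    measurable_const.indicator (measurableSet_allObserved _)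
  have h4 : Measurable ((psiEvent G a s).indicator fun _ => (1 : ℝ)) :=
    measurable_const.indicator (measurableSet_psiEvent _ _)
  have h5 : Measurable fun ω : FullData d => ω.1 a := by fun_prop
  exact ((h5.mul h1).mul h3).add (h2.mul (h4.sub (h3.mul h1)))

theorem measurable_eif (P : ProbabilityMeasure (FullData d)) : Measurable (eif G a s P) :=
  (measurable_leif P).sub_const _

theorem restrict_psiEvent (μ : Measure (FullData d)) :
    μ.restrict (psiEvent G a s) =
      Measure.sum fun r : psiPatterns G a s => μ.restrict (patternEq (r : Pattern d)) := by
  have : psiEvent G a s = ⋃ r ∈ psiPatterns G a s, patternEq r := by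
    ext ω
    simp [psiEvent, patternEq]
  rw [this]
  refine Measure.restrict_biUnion (Set.to_countable _) ?_ measurableSet_patternEq
  intro r _ r' _ h
  refine Set.disjoint_left.2 fun ω (hω : ω.2 = r) (hω' : ω.2 = r') => h (hω.symm.trans hω')

variable {P : ProbabilityMeasure (FullData d)}

/-- On `{ψ(R̄) = s}` the conditional law of `X_s` given `X_{N(s)}` is the one on `{R ≥ N̄(s)}`. -/
theorem map_restrict_psiEvent_eq_compProd (has : a ∈ s) (hP : P ∈ model G) :
    ((P : Measure (FullData d)).restrict (psiEvent G a s)).map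
        (fun ω => (subvec (boundary G s) ω, subvec s ω)) =
      (((P : Measure (FullData d)).restrict (psiEvent G a s)).map (subvec (boundary G s))) ⊗ₘ
        condDistrib (subvec s) (subvec (boundary G s))
          ((P : Measure (FullData d)).restrict (allObserved (closedNbhd G s))) := by
  have hN := measurable_subvec (boundary G s)
  have hs := measurable_subvec s
  rw [restrict_psiEvent, Measure.map_sum hN.aemeasurable,
    Measure.map_sum (hN.prodMk hs).aemeasurable, Measure.compProd_sum_left]
  congr 1
  ext1 r
  rw [← compProd_map_condDistrib hs.aemeasurable]
  exact Measure.compProd_congr (hP.2 r s (mem_components_of_psi_eq has r.2)).2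

theorem map_psiEvent_absolutelyContinuous (has : a ∈ s) (hP : P ∈ model G) :
    ((P : Measure (FullData d)).restrict (psiEvent G a s)).map (subvec (boundary G s)) ≪
      ((P : Measure (FullData d)).restrict (allObserved (closedNbhd G s))).map
        (subvec (boundary G s)) := by
  rw [restrict_psiEvent, Measure.map_sum (measurable_subvec _).aemeasurable]
  refine Measure.absolutelyContinuous_sum_left fun r => ?_
  exact (hP.2 r s (mem_components_of_psi_eq has r.2)).1

theorem map_psiEvent_eq_withDensity (has : a ∈ s) (hP : P ∈ model G) :
    ((P : Measure (FullData d)).restrict (psiEvent G a s)).map (subvec (boundary G s)) =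
      (((P : Measure (FullData d)).restrict (allObserved (closedNbhd G s))).map
        (subvec (boundary G s))).withDensity fun z => ENNReal.ofReal (odds G a s P z) :=
  map_restrict_eq_withDensity_odds (R := fun ω : FullData d => ω.2) (measurable_subvec _)
    measurable_snd MeasurableSet.of_discrete MeasurableSet.of_discrete
    (map_psiEvent_absolutelyContinuous has hP)

/-- Weighting by the odds transports the law of `(X_{N(s)}, X_a)` on `{R ≥ N̄(s)}`, which is
observed, to the law on `{ψ(R̄) = s}`, which is not. -/
theorem map_psiEvent_eq_map_withDensity (has : a ∈ s) (hP : P ∈ model G) :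
    ((P : Measure (FullData d)).restrict (psiEvent G a s)).map
        (fun ω => (subvec (boundary G s) ω, ω.1 a)) =
      (((P : Measure (FullData d)).restrict (allObserved (closedNbhd G s))).withDensity
        fun ω => ENNReal.ofReal (odds G a s P (subvec (boundary G s) ω))).map
        (fun ω => (subvec (boundary G s) ω, ω.1 a)) := by
  have hN := measurable_subvec (boundary G s)
  have hs := measurable_subvec s
  have hO : Measurable fun z => ENNReal.ofReal (odds G a s P z) :=
    (measurable_odds P).ennreal_ofReal
  have key : ((P : Measure (FullData d)).restrict (psiEvent G a s)).map
        (fun ω => (subvec (boundary G s) ω, subvec s ω)) =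
      (((P : Measure (FullData d)).restrict (allObserved (closedNbhd G s))).withDensity
        fun ω => ENNReal.ofReal (odds G a s P (subvec (boundary G s) ω))).map
        (fun ω => (subvec (boundary G s) ω, subvec s ω)) := by
    rw [map_restrict_psiEvent_eq_compProd has hP, map_psiEvent_eq_withDensity has hP,
      withDensity_compProd_left hO, compProd_map_condDistrib hs.aemeasurable]
    exact (map_withDensity_comp (hN.prodMk hs) (hO.comp measurable_fst)).symm
  have he : Measurable fun p : (boundary G s → ℝ) × (s → ℝ) => (p.1, p.2 ⟨a, has⟩) := by fun_prop
  have := congrArg (fun μ => μ.map fun p : (boundary G s → ℝ) × (s → ℝ) => (p.1, p.2 ⟨a, has⟩)) key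
  simp only [Measure.map_map he (hN.prodMk hs)] at this
  exact this

/-- `map_psiEvent_eq_map_withDensity` in terms of integrability; the integrals are compared in
`setIntegral_psiEvent`. -/
theorem integrableOn_psiEvent_iff (has : a ∈ s) (hP : P ∈ model G)
    {h : (boundary G s → ℝ) × ℝ → ℝ} (hh : Measurable h) :
    IntegrableOn (fun ω => h (subvec (boundary G s) ω, ω.1 a)) (psiEvent G a s)
        (P : Measure (FullData d)) ↔
      IntegrableOn (fun ω => odds G a s P (subvec (boundary G s) ω) *
        h (subvec (boundary G s) ω, ω.1 a)) (allObserved (closedNbhd G s))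
        (P : Measure (FullData d)) := by
  have hN := measurable_subvec (boundary G s)
  have hXa : Measurable fun ω : FullData d => ω.1 a := by fun_prop
  have hO : Measurable fun ω => ENNReal.ofReal (odds G a s P (subvec (boundary G s) ω)) :=
    ((measurable_odds P).comp hN).ennreal_ofReal
  have e1 := integrable_map_measure
    (μ := (P : Measure (FullData d)).restrict (psiEvent G a s))
    hh.aestronglyMeasurable (hN.prodMk hXa).aemeasurable
  have e2 := integrable_map_measure
    (μ := ((P : Measure (FullData d)).restrict (allObserved (closedNbhd G s))).withDensity
        fun ω => ENNReal.ofReal (odds G a s P (subvec (boundary G s) ω)))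
    hh.aestronglyMeasurable (hN.prodMk hXa).aemeasurable
  rw [map_psiEvent_eq_map_withDensity has hP] at e1
  have e3 := e1.symm.trans e2
  rw [integrable_withDensity_iff_integrable_smul' hO (by simp)] at e3
  simpa [IntegrableOn, Function.comp_def, odds_nonneg] using e3

theorem setIntegral_psiEvent (has : a ∈ s) (hP : P ∈ model G)
    {h : (boundary G s → ℝ) × ℝ → ℝ} (hh : Measurable h) :
    ∫ ω in psiEvent G a s, h (subvec (boundary G s) ω, ω.1 a) ∂(P : Measure (FullData d)) =
      ∫ ω in allObserved (closedNbhd G s), odds G a s P (subvec (boundary G s) ω) *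
        h (subvec (boundary G s) ω, ω.1 a) ∂(P : Measure (FullData d)) := by
  have hN := measurable_subvec (boundary G s)
  have hXa : Measurable fun ω : FullData d => ω.1 a := by fun_prop
  have hO : Measurable fun ω => ENNReal.ofReal (odds G a s P (subvec (boundary G s) ω)) :=
    ((measurable_odds P).comp hN).ennreal_ofReal
  have e1 := integral_map (μ := (P : Measure (FullData d)).restrict (psiEvent G a s))
    (hN.prodMk hXa).aemeasurable hh.aestronglyMeasurable
  have e2 := integral_map
    (μ := ((P : Measure (FullData d)).restrict (allObserved (closedNbhd G s))).withDensity
        fun ω => ENNReal.ofReal (odds G a s P (subvec (boundary G s) ω)))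
    (hN.prodMk hXa).aemeasurable hh.aestronglyMeasurable
  rw [map_psiEvent_eq_map_withDensity has hP] at e1
  have e3 := e1.symm.trans e2
  rw [integral_withDensity_eq_integral_toReal_smul hO (by simp)] at e3
  simpa [odds_nonneg] using e3

/-- The regression function is the conditional mean of `X_a` given `X_{N(s)}` on `{R ≥ N̄(s)}`: if
`u(X_{N(s)}) X_a` is integrable there, then so is `u(X_{N(s)}) m_s(X_{N(s)})`, with the same
integral. -/
theorem integrableOn_regression_mul {u : (boundary G s → ℝ) → ℝ} (hu : Measurable u)
    (hi : IntegrableOn (fun ω : FullData d => u (subvec (boundary G s) ω) * ω.1 a)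
      (allObserved (closedNbhd G s)) (P : Measure (FullData d))) :
    IntegrableOn (fun ω => u (subvec (boundary G s) ω) *
        regression G a s P (subvec (boundary G s) ω)) (allObserved (closedNbhd G s))
        (P : Measure (FullData d)) ∧
      ∫ ω in allObserved (closedNbhd G s), u (subvec (boundary G s) ω) *
        regression G a s P (subvec (boundary G s) ω) ∂(P : Measure (FullData d)) =
      ∫ ω in allObserved (closedNbhd G s), u (subvec (boundary G s) ω) * ω.1 a
        ∂(P : Measure (FullData d)) := by
  have hN := measurable_subvec (boundary G s)
  have hXa : Measurable fun ω : FullData d => ω.1 a := by fun_prop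
  have hf : Measurable fun p : (boundary G s → ℝ) × ℝ => u p.1 * p.2 := by fun_prop
  have hi' : Integrable (fun p : (boundary G s → ℝ) × ℝ => u p.1 * p.2)
      (((P : Measure (FullData d)).restrict (allObserved (closedNbhd G s))).map
        fun ω => (subvec (boundary G s) ω, ω.1 a)) := by
    rw [integrable_map_measure hf.aestronglyMeasurable (hN.prodMk hXa).aemeasurable]
    exact hi
  have e1 : ∀ z, u z * regression G a s P z = ∫ y, u z * y
      ∂(condDistrib (fun ω : FullData d => ω.1 a) (subvec (boundary G s))
        ((P : Measure (FullData d)).restrict (allObserved (closedNbhd G s))) z) := fun z => by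
    rw [regression, integral_const_mul]
  constructor
  · simp_rw [e1]
    exact hi'.integral_condDistrib hN.aemeasurable hXa.aemeasurable
  · simp_rw [e1]
    have h2 := hi'
    rw [← compProd_map_condDistrib hXa.aemeasurable] at h2
    have h3 := Measure.integral_compProd h2
    rw [compProd_map_condDistrib hXa.aemeasurable,
      integral_map (hN.prodMk hXa).aemeasurable hf.aestronglyMeasurable,
      integral_map hN.aemeasurable] at h3
    · exact h3.symm
    · exact (StronglyMeasurable.integral_kernel_prod_right'
        hf.stronglyMeasurable).aestronglyMeasurable

end Model

/-! ### Moments of the influence function -/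

section Moments

variable {d : ℕ} {G : SimpleGraph (Fin d)} {a : Fin d} {s : Finset (Fin d)}
  {P : ProbabilityMeasure (FullData d)}

theorem integrable_targetVar_iff (Q : ProbabilityMeasure (FullData d)) :
    Integrable (targetVar G a s) (Q : Measure (FullData d)) ↔
      IntegrableOn (fun ω : FullData d => ω.1 a) (psiEvent G a s) (Q : Measure (FullData d)) :=
  integrable_indicator_iff (measurableSet_psiEvent a s)

theorem mu_eq_setIntegral (Q : ProbabilityMeasure (FullData d)) :
    mu G a s Q = ∫ ω in psiEvent G a s, ω.1 a ∂(Q : Measure (FullData d)) :=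
  integral_indicator (measurableSet_psiEvent a s)

theorem leif_eq_indicator (P : ProbabilityMeasure (FullData d)) (ω : FullData d) :
    leif G a s P ω =
      (allObserved (closedNbhd G s)).indicator (fun ω => odds G a s P (subvec (boundary G s) ω) *
        ω.1 a) ω -
      (allObserved (closedNbhd G s)).indicator (fun ω => odds G a s P (subvec (boundary G s) ω) *
        regression G a s P (subvec (boundary G s) ω)) ω +
      (psiEvent G a s).indicator (fun ω => regression G a s P (subvec (boundary G s) ω)) ω := by
  unfold leif
  by_cases hE : ω ∈ allObserved (closedNbhd G s) <;> by_cases hF : ω ∈ psiEvent G a s <;>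
    simp [hE, hF] <;> ring

/-- The integrability of `X_a` and of `m_s` on the events `{ψ(R̄) = s}` and `{R ≥ N̄(s)}`, the
latter with the odds as weights, and the equality of the four integrals. -/
theorem integrableOn_and_setIntegral_eq_mu (has : a ∈ s) (hP : P ∈ model G)
    (hint : Integrable (targetVar G a s) (P : Measure (FullData d))) :
    (IntegrableOn (fun ω => odds G a s P (subvec (boundary G s) ω) * ω.1 a)
        (allObserved (closedNbhd G s)) (P : Measure (FullData d)) ∧
      ∫ ω in allObserved (closedNbhd G s), odds G a s P (subvec (boundary G s) ω) * ω.1 a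
        ∂(P : Measure (FullData d)) = mu G a s P) ∧
    (IntegrableOn (fun ω => odds G a s P (subvec (boundary G s) ω) *
        regression G a s P (subvec (boundary G s) ω))
        (allObserved (closedNbhd G s)) (P : Measure (FullData d)) ∧
      ∫ ω in allObserved (closedNbhd G s), odds G a s P (subvec (boundary G s) ω) *
        regression G a s P (subvec (boundary G s) ω) ∂(P : Measure (FullData d)) = mu G a s P) ∧
    (IntegrableOn (fun ω => regression G a s P (subvec (boundary G s) ω)) (psiEvent G a s)
        (P : Measure (FullData d)) ∧
      ∫ ω in psiEvent G a s, regression G a s P (subvec (boundary G s) ω)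
        ∂(P : Measure (FullData d)) = mu G a s P) := by
  have hF := (integrable_targetVar_iff P).1 hint
  have hO := (integrableOn_psiEvent_iff has hP measurable_snd).1 hF
  have hOi := setIntegral_psiEvent has hP (h := Prod.snd) measurable_snd
  rw [← mu_eq_setIntegral] at hOi
  obtain ⟨hm, hmi⟩ := integrableOn_regression_mul (measurable_odds P) hO
  have hr : Measurable fun p : (boundary G s → ℝ) × ℝ => regression G a s P p.1 :=
    (measurable_regression P).comp measurable_fst
  refine ⟨⟨hO, hOi.symm⟩, ⟨hm, hmi.trans hOi.symm⟩, (integrableOn_psiEvent_iff has hP hr).2 hm, ?_⟩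
  exact (setIntegral_psiEvent has hP hr).trans (hmi.trans hOi.symm)

theorem integrable_mul_of_abs_le {Ω : Type*} [MeasurableSpace Ω] {μ : Measure Ω} {f k : Ω → ℝ}
    {C : ℝ} (hf : Integrable f μ) (hk : Measurable k) (hC : ∀ o, |k o| ≤ C) :
    Integrable (fun ω => f ω * k ω) μ :=
  hf.mul_bdd hk.aestronglyMeasurable (ae_of_all _ hC)

theorem integrable_leif_mul (has : a ∈ s) (hP : P ∈ model G)
    (hint : Integrable (targetVar G a s) (P : Measure (FullData d))) {k : FullData d → ℝ} {C : ℝ}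
    (hk : Measurable k) (hC : ∀ o, |k o| ≤ C) :
    Integrable (fun ω => leif G a s P ω * k ω) (P : Measure (FullData d)) ∧
    ∫ ω, leif G a s P ω * k ω ∂(P : Measure (FullData d)) =
      ∫ ω in allObserved (closedNbhd G s), odds G a s P (subvec (boundary G s) ω) * ω.1 a * k ω
          ∂(P : Measure (FullData d)) -
        ∫ ω in allObserved (closedNbhd G s), odds G a s P (subvec (boundary G s) ω) *
          regression G a s P (subvec (boundary G s) ω) * k ω ∂(P : Measure (FullData d)) +
        ∫ ω in psiEvent G a s, regression G a s P (subvec (boundary G s) ω) * k ω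
          ∂(P : Measure (FullData d)) := by
  obtain ⟨⟨h1, -⟩, ⟨h2, -⟩, ⟨h3, -⟩⟩ := integrableOn_and_setIntegral_eq_mu has hP hint
  have hE := measurableSet_allObserved (d := d) (closedNbhd G s)
  have hF := measurableSet_psiEvent (G := G) a s
  have h1 := (integrable_indicator_iff hE).2 (integrable_mul_of_abs_le h1 hk hC)
  have h2 := (integrable_indicator_iff hE).2 (integrable_mul_of_abs_le h2 hk hC)
  have h3 := (integrable_indicator_iff hF).2 (integrable_mul_of_abs_le h3 hk hC)
  have e : (fun ω => leif G a s P ω * k ω) =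
      (allObserved (closedNbhd G s)).indicator (fun ω => odds G a s P (subvec (boundary G s) ω) *
        ω.1 a * k ω) -
      (allObserved (closedNbhd G s)).indicator (fun ω => odds G a s P (subvec (boundary G s) ω) *
        regression G a s P (subvec (boundary G s) ω) * k ω) +
      (psiEvent G a s).indicator
        (fun ω => regression G a s P (subvec (boundary G s) ω) * k ω) := by
    ext ω
    rw [leif_eq_indicator, add_mul, sub_mul]
    simp only [Set.indicator_mul_left, Pi.add_apply, Pi.sub_apply]
  rw [e]
  refine ⟨(h1.sub h2).add h3, ?_⟩
  rw [integral_add' (h1.sub h2) h3, integral_sub' h1 h2, integral_indicator hE,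
    integral_indicator hE, integral_indicator hF]

theorem integrable_eif (has : a ∈ s) (hP : P ∈ model G)
    (hint : Integrable (targetVar G a s) (P : Measure (FullData d))) :
    Integrable (eif G a s P) (obsLaw P) ∧ ∫ o, eif G a s P o ∂(obsLaw P) = 0 := by
  obtain ⟨h, h'⟩ := integrable_leif_mul (C := 1) has hP hint (k := fun _ => 1) measurable_const
    (by simp)
  obtain ⟨⟨-, h1⟩, ⟨-, h2⟩, ⟨-, h3⟩⟩ := integrableOn_and_setIntegral_eq_mu has hP hint
  simp only [mul_one, h1, h2, h3] at h h'
  rw [integrable_obsLaw_iff P (measurable_eif P) (eif_observe has P),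
    integral_obsLaw P (measurable_eif P) (eif_observe has P)]
  unfold eif
  refine ⟨h.sub (integrable_const _), ?_⟩
  rw [integral_sub h (integrable_const _), h']
  simp

/-- As scores have mean zero, the influence function need not be centred. -/
theorem integral_eif_mul_score (has : a ∈ s) (hP : P ∈ model G)
    (hint : Integrable (targetVar G a s) (P : Measure (FullData d))) {g : FullData d → ℝ} {C : ℝ}
    (hg : Measurable g) (hC : ∀ o, |g o| ≤ C) (hg0 : ∫ o, g o ∂(obsLaw P) = 0) :
    ∫ o, eif G a s P o * g o ∂(obsLaw P) =
      ∫ ω, leif G a s P ω * g (observe ω) ∂(P : Measure (FullData d)) := by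
  have h : Integrable (fun ω => leif G a s P ω * g (observe ω)) (P : Measure (FullData d)) :=
    (integrable_leif_mul has hP hint (hg.comp measurable_observe) fun o => hC (observe o)).1
  have hg' : Integrable (fun ω => g (observe ω)) (P : Measure (FullData d)) :=
    Integrable.of_bound (hg.comp measurable_observe).aestronglyMeasurable C
      (ae_of_all _ fun o => hC (observe o))
  rw [obsLaw, integral_map measurable_observe.aemeasurable hg.aestronglyMeasurable] at hg0
  have hm : Measurable fun o => eif G a s P o * g o := (measurable_eif P).mul hg
  rw [obsLaw, integral_map measurable_observe.aemeasurable hm.aestronglyMeasurable]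
  simp_rw [eif_observe has P, eif, sub_mul]
  rw [integral_sub h (hg'.const_mul _), integral_const_mul, hg0, mul_zero, sub_zero]

end Moments

/-! ### Perturbation of the odds -/

section Odds

/-- If `νE'` is at least `c` times `νE` and `νF'` at most `c'` times `νF`, then the density of `νF'`
with respect to `νE'` is at most `c' / c` times the density of `νF` with respect to `νE`. -/
theorem ae_mul_le_of_smul_le {β : Type*} [MeasurableSpace β] {νE νE' νF νF' : Measure β}
    [IsFiniteMeasure νE] {f f' : β → ℝ≥0∞} {c c' : ℝ≥0∞} (hf : Measurable f) (hf' : Measurable f')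
    (hνF : νF = νE.withDensity f) (hνF' : νF' = νE'.withDensity f')
    (hE : c • νE ≤ νE') (hF : νF' ≤ c' • νF) : ∀ᵐ z ∂νE, c * f' z ≤ c' * f z := by
  refine ae_le_of_forall_setLIntegral_le_of_sigmaFinite (hf'.const_mul c) fun A hA _ => ?_
  calc ∫⁻ z in A, c * f' z ∂νE = ∫⁻ z in A, f' z ∂(c • νE) := by
        rw [lintegral_const_mul _ hf', Measure.restrict_smul, lintegral_smul_measure, smul_eq_mul]
    _ ≤ ∫⁻ z in A, f' z ∂νE' := lintegral_mono' (Measure.restrict_mono le_rfl hE) le_rfl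
    _ = νF' A := by rw [hνF', withDensity_apply _ hA]
    _ ≤ (c' • νF) A := hF A
    _ = ∫⁻ z in A, c' * f z ∂νE := by
        rw [lintegral_const_mul _ hf, hνF, Measure.smul_apply, withDensity_apply _ hA, smul_eq_mul]

/-- The lower bound that corresponds to `ae_mul_le_of_smul_le`. -/
theorem ae_mul_le_of_le_smul {β : Type*} [MeasurableSpace β] {νE νE' νF νF' : Measure β}
    [IsFiniteMeasure νE] {f f' : β → ℝ≥0∞} {c c' : ℝ≥0∞} (hf : Measurable f) (hf' : Measurable f')
    (hνF : νF = νE.withDensity f) (hνF' : νF' = νE'.withDensity f')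
    (hE : νE' ≤ c' • νE) (hF : c • νF ≤ νF') : ∀ᵐ z ∂νE, c * f z ≤ c' * f' z := by
  refine ae_le_of_forall_setLIntegral_le_of_sigmaFinite (hf.const_mul c) fun A hA _ => ?_
  calc ∫⁻ z in A, c * f z ∂νE = (c • νF) A := by
        rw [lintegral_const_mul _ hf, hνF, Measure.smul_apply, withDensity_apply _ hA, smul_eq_mul]
    _ ≤ νF' A := hF A
    _ = ∫⁻ z in A, f' z ∂νE' := by rw [hνF', withDensity_apply _ hA]
    _ ≤ ∫⁻ z in A, f' z ∂(c' • νE) := lintegral_mono' (Measure.restrict_mono le_rfl hE) le_rfl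
    _ = ∫⁻ z in A, c' * f' z ∂νE := by
        rw [lintegral_const_mul _ hf', Measure.restrict_smul, lintegral_smul_measure, smul_eq_mul]

variable {d : ℕ} {G : SimpleGraph (Fin d)} {a : Fin d} {s : Finset (Fin d)}
  {P Q : ProbabilityMeasure (FullData d)} {g : FullData d → ℝ} {C t : ℝ}

theorem smul_obsLaw_le (hC : ∀ o, |g o| ≤ C)
    (hQ : obsLaw Q = (obsLaw P).withDensity fun o => ENNReal.ofReal (1 + t * g o)) :
    ENNReal.ofReal (1 - |t| * C) • obsLaw P ≤ obsLaw Q := by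
  rw [hQ, ← withDensity_const]
  refine withDensity_mono (ae_of_all _ fun o => ENNReal.ofReal_le_ofReal ?_)
  have h := neg_abs_le (t * g o)
  rw [abs_mul] at h
  nlinarith [abs_nonneg t, hC o]

theorem obsLaw_le_smul (hC : ∀ o, |g o| ≤ C)
    (hQ : obsLaw Q = (obsLaw P).withDensity fun o => ENNReal.ofReal (1 + t * g o)) :
    obsLaw Q ≤ ENNReal.ofReal (1 + |t| * C) • obsLaw P := by
  rw [hQ, ← withDensity_const]
  refine withDensity_mono (ae_of_all _ fun o => ENNReal.ofReal_le_ofReal ?_)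
  have h := le_abs_self (t * g o)
  rw [abs_mul] at h
  nlinarith [abs_nonneg t, hC o]

theorem map_restrict_obsLaw_allObserved (P : ProbabilityMeasure (FullData d)) :
    ((obsLaw P).restrict (allObserved (closedNbhd G s))).map (subvec (boundary G s)) =
      ((P : Measure (FullData d)).restrict (allObserved (closedNbhd G s))).map
        (subvec (boundary G s)) :=
  map_restrict_obsLaw P (measurable_subvec _) fun _ hω => subvec_boundary_observe_of_allObserved hω

theorem map_restrict_obsLaw_psiEvent (has : a ∈ s) (P : ProbabilityMeasure (FullData d)) :
    ((obsLaw P).restrict (psiEvent G a s)).map (subvec (boundary G s)) =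
      ((P : Measure (FullData d)).restrict (psiEvent G a s)).map (subvec (boundary G s)) :=
  map_restrict_obsLaw P (measurable_subvec _) fun _ hω => subvec_boundary_observe_of_psiEvent has hω

/-- The odds are Lipschitz along a submodel, relative to the odds at the base point. -/
theorem abs_odds_sub_le (has : a ∈ s) (hP : P ∈ model G) (hQM : Q ∈ model G)
    (hC : ∀ o, |g o| ≤ C) (ht : |t| * C ≤ 1 / 2)
    (hQ : obsLaw Q = (obsLaw P).withDensity fun o => ENNReal.ofReal (1 + t * g o)) :
    ∀ᵐ ω ∂((P : Measure (FullData d)).restrict (allObserved (closedNbhd G s))),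
      |odds G a s Q (subvec (boundary G s) ω) - odds G a s P (subvec (boundary G s) ω)| ≤
        4 * (|t| * C) * odds G a s P (subvec (boundary G s) ω) := by
  have hN := measurable_subvec (boundary G s)
  have hδ : 0 ≤ |t| * C := by
    obtain ⟨o⟩ : Nonempty (FullData d) := ⟨0, fun _ => false⟩
    have := (abs_nonneg _).trans (hC o)
    positivity
  have hle := smul_obsLaw_le hC hQ
  have hge := obsLaw_le_smul hC hQ
  have mono : ∀ {μ ν : Measure (FullData d)} (T : Set (FullData d)), μ ≤ ν →
      (μ.restrict T).map (subvec (boundary G s)) ≤ (ν.restrict T).map (subvec (boundary G s)) :=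
    fun T h => Measure.map_mono (Measure.restrict_mono le_rfl h) hN
  have hEl := mono (allObserved (closedNbhd G s)) hle
  have hEg := mono (allObserved (closedNbhd G s)) hge
  have hFl := mono (psiEvent G a s) hle
  have hFg := mono (psiEvent G a s) hge
  simp only [Measure.restrict_smul, Measure.map_smul, map_restrict_obsLaw_allObserved,
    map_restrict_obsLaw_psiEvent has] at hEl hEg hFl hFg
  have mP := (measurable_odds (G := G) (a := a) (s := s) P).ennreal_ofReal
  have mQ := (measurable_odds (G := G) (a := a) (s := s) Q).ennreal_ofReal
  have h1 := ae_mul_le_of_smul_le mP mQ (map_psiEvent_eq_withDensity has hP)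
    (map_psiEvent_eq_withDensity has hQM) hEl hFg
  have h2 := ae_mul_le_of_le_smul mP mQ (map_psiEvent_eq_withDensity has hP)
    (map_psiEvent_eq_withDensity has hQM) hEg hFl
  filter_upwards [ae_of_ae_map hN.aemeasurable h1, ae_of_ae_map hN.aemeasurable h2] with ω h1 h2
  have oP := odds_nonneg (G := G) (a := a) (s := s) P (subvec (boundary G s) ω)
  have oQ := odds_nonneg (G := G) (a := a) (s := s) Q (subvec (boundary G s) ω)
  rw [← ENNReal.ofReal_mul (by linarith), ← ENNReal.ofReal_mul (by linarith),
    ENNReal.ofReal_le_ofReal_iff (by positivity)] at h1 h2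
  set x := odds G a s P (subvec (boundary G s) ω)
  set y := odds G a s Q (subvec (boundary G s) ω)
  set δ := |t| * C
  -- `(1 + δ) / (1 - δ) ≤ 1 + 4 δ` for `δ ≤ 1 / 2`, and `(1 - δ) / (1 + δ) ≥ 1 - 2 δ`
  have hyx : y ≤ 3 * x := by nlinarith
  have hδx := mul_nonneg hδ oP
  rw [abs_le]
  constructor
  · nlinarith [mul_nonneg hδ (sub_nonneg.2 ht), mul_nonneg hδ oQ]
  · nlinarith [mul_le_mul_of_nonneg_left hyx hδ]

end Odds

/-! ### The derivative along a submodel -/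

section Derivative

variable {d : ℕ} {G : SimpleGraph (Fin d)} {a : Fin d} {s : Finset (Fin d)}
  {P Q : ProbabilityMeasure (FullData d)} {g : FullData d → ℝ} {C t : ℝ}

theorem half_le_one_add_mul (hC : ∀ o, |g o| ≤ C) (ht : |t| * C ≤ 1 / 2) (o : FullData d) :
    1 / 2 ≤ 1 + t * g o := by
  have h := neg_abs_le (t * g o)
  rw [abs_mul] at h
  nlinarith [abs_nonneg t, hC o]

/-- The mean of a function of the observed data is affine along a submodel. -/
theorem integral_of_obsLaw_eq (hg : Measurable g) (hC : ∀ o, |g o| ≤ C) (ht : |t| * C ≤ 1 / 2)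
    (hQ : obsLaw Q = (obsLaw P).withDensity fun o => ENNReal.ofReal (1 + t * g o))
    {f : FullData d → ℝ} (hf : Measurable f) (hobs : ∀ ω, f (observe ω) = f ω)
    (hi : Integrable f (P : Measure (FullData d))) :
    Integrable f (Q : Measure (FullData d)) ∧
      ∫ ω, f ω ∂(Q : Measure (FullData d)) = ∫ ω, f ω ∂(P : Measure (FullData d)) +
        t * ∫ ω, f ω * g (observe ω) ∂(P : Measure (FullData d)) := by
  have hpos : ∀ o, 0 ≤ 1 + t * g o := fun o => by linarith [half_le_one_add_mul hC ht o]
  have hd : Measurable fun o => ENNReal.ofReal (1 + t * g o) := by fun_prop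
  have hio := (integrable_obsLaw_iff P hf hobs).2 hi
  have hfg : Integrable (fun o => f o * g o) (obsLaw P) := integrable_mul_of_abs_le hio hg hC
  have hfg' : ∫ o, f o * g o ∂(obsLaw P) =
      ∫ ω, f ω * g (observe ω) ∂(P : Measure (FullData d)) := by
    have hm : Measurable fun o => f o * g o := hf.mul hg
    rw [obsLaw, integral_map measurable_observe.aemeasurable hm.aestronglyMeasurable]
    simp_rw [hobs]
  rw [← integrable_obsLaw_iff Q hf hobs, ← integral_obsLaw Q hf hobs, ← integral_obsLaw P hf hobs,
    hQ, integrable_withDensity_iff_integrable_smul' hd (by simp),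
    integral_withDensity_eq_integral_toReal_smul hd (by simp), ← hfg', ← integral_const_mul,
    ← integral_add hio (hfg.const_mul t)]
  have e : (fun o => (ENNReal.ofReal (1 + t * g o)).toReal • f o) =
      fun o => f o + t * (f o * g o) := by
    ext o
    rw [ENNReal.toReal_ofReal (hpos o), smul_eq_mul]
    ring
  rw [e]
  exact ⟨hio.add (hfg.const_mul t), rfl⟩

theorem setIntegral_of_obsLaw_eq (hg : Measurable g) (hC : ∀ o, |g o| ≤ C)
    (ht : |t| * C ≤ 1 / 2)
    (hQ : obsLaw Q = (obsLaw P).withDensity fun o => ENNReal.ofReal (1 + t * g o))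
    {T : Set (Pattern d)} {A : Set (FullData d)}
    (hA : A = {ω | ω.2 ∈ T}) {f : FullData d → ℝ} (hf : Measurable f)
    (hobs : ∀ ω : FullData d, ω.2 ∈ T → f (observe ω) = f ω)
    (hi : IntegrableOn f A (P : Measure (FullData d))) :
    IntegrableOn f A (Q : Measure (FullData d)) ∧
      ∫ ω in A, f ω ∂(Q : Measure (FullData d)) =
        ∫ ω in A, f ω ∂(P : Measure (FullData d)) +
        t * ∫ ω in A, f ω * g (observe ω) ∂(P : Measure (FullData d)) := by
  subst hA
  have hT := measurableSet_pattern_preimage T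
  have hobs' : ∀ ω, {ω : FullData d | ω.2 ∈ T}.indicator f (observe ω) =
      {ω : FullData d | ω.2 ∈ T}.indicator f ω := by
    intro ω
    by_cases h : ω.2 ∈ T
    · simp [Set.indicator, observe_snd, h, hobs ω h]
    · simp [Set.indicator, observe_snd, h]
  have := integral_of_obsLaw_eq hg hC ht hQ (hf.indicator hT) hobs'
    ((integrable_indicator_iff hT).2 hi)
  have e : (fun ω => {ω : FullData d | ω.2 ∈ T}.indicator f ω * g (observe ω)) =
      {ω : FullData d | ω.2 ∈ T}.indicator fun ω => f ω * g (observe ω) := by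
    ext ω
    rw [Set.indicator_mul_left]
  simpa only [integrable_indicator_iff hT, integral_indicator hT, e] using this

/-- The first-order expansion of `μ_s` along a submodel has a quadratic remainder. The remainder is
`t` times the `P`-mean of `(X_a - m_s) (O_s(Q) - O_s(P)) g` on `{R ≥ N̄(s)}`: without the factor `g`
that mean would vanish by conditioning on `X_{N(s)}`, and the change of the odds is of order `t`. -/
theorem abs_mu_sub_le (has : a ∈ s) (hP : P ∈ model G)
    (hint : Integrable (targetVar G a s) (P : Measure (FullData d))) (hQM : Q ∈ model G)
    (hg : Measurable g) (hC : ∀ o, |g o| ≤ C) (hg0 : ∫ o, g o ∂(obsLaw P) = 0)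
    (ht : |t| * C ≤ 1 / 2)
    (hQ : obsLaw Q = (obsLaw P).withDensity fun o => ENNReal.ofReal (1 + t * g o)) :
    Integrable (targetVar G a s) (Q : Measure (FullData d)) ∧
      |mu G a s Q - mu G a s P - t * ∫ o, eif G a s P o * g o ∂(obsLaw P)| ≤
        (4 * C * C * ∫ ω in allObserved (closedNbhd G s),
          |odds G a s P (subvec (boundary G s) ω) * ω.1 a - odds G a s P (subvec (boundary G s) ω) *
            regression G a s P (subvec (boundary G s) ω)| ∂(P : Measure (FullData d))) * t ^ 2 := by
  obtain ⟨⟨hOX, -⟩, ⟨hOm, -⟩, ⟨hm, hmi⟩⟩ := integrableOn_and_setIntegral_eq_mu has hP hint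
  have hN : Measurable (subvec (d := d) (boundary G s)) := measurable_subvec _
  have hXa : Measurable fun ω : FullData d => ω.1 a := by fun_prop
  have hg' : Measurable fun ω : FullData d => g (observe ω) := hg.comp measurable_observe
  have hC' : ∀ ω : FullData d, |g (observe ω)| ≤ C := fun ω => hC _
  have mQ : Measurable fun ω : FullData d => odds G a s Q (subvec (boundary G s) ω) :=
    (measurable_odds Q).comp hN
  have mr : Measurable fun ω : FullData d => regression G a s P (subvec (boundary G s) ω) :=
    (measurable_regression P).comp hN
  have hC0 : 0 ≤ C := (abs_nonneg _).trans (hC ⟨0, fun _ => false⟩)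
  have hodds := abs_odds_sub_le has hP hQM hC ht hQ
  have hQX : IntegrableOn (fun ω => odds G a s Q (subvec (boundary G s) ω) * ω.1 a)
      (allObserved (closedNbhd G s)) (P : Measure (FullData d)) := by
    -- the odds under `Q` are at most three times those under `P`
    refine Integrable.mono' (hOX.norm.const_mul 3) (mQ.mul hXa).aestronglyMeasurable ?_
    filter_upwards [hodds] with ω h
    have oP := odds_nonneg (G := G) (a := a) (s := s) P (subvec (boundary G s) ω)
    have oQ := odds_nonneg (G := G) (a := a) (s := s) Q (subvec (boundary G s) ω)
    rw [norm_mul, norm_mul, Real.norm_of_nonneg oP, Real.norm_of_nonneg oQ, ← mul_assoc]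
    refine mul_le_mul_of_nonneg_right ?_ (norm_nonneg _)
    have := (abs_le.1 h).2
    nlinarith
  obtain ⟨hQm, hQmi⟩ := integrableOn_regression_mul (measurable_odds Q) hQX
  -- transport of the three observed integrals from `P` to `Q`
  obtain ⟨t1, t1i⟩ := setIntegral_of_obsLaw_eq hg hC ht hQ (T := patternsGE (closedNbhd G s))
    (A := allObserved (closedNbhd G s)) rfl
    (mQ.mul hXa) (fun ω hω => by
      have h1 : subvec (boundary G s) (observe ω) = subvec (boundary G s) ω :=
        subvec_boundary_observe_of_allObserved hω
      have h2 : (observe ω).1 a = ω.1 a :=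
        observe_fst_of_eq_true (hω a (Finset.mem_union_left _ has))
      simp only [Pi.mul_apply, h1, h2]) hQX
  obtain ⟨-, t2i⟩ := setIntegral_of_obsLaw_eq hg hC ht hQ (T := patternsGE (closedNbhd G s))
    (A := allObserved (closedNbhd G s)) rfl
    (mQ.mul mr) (fun ω hω => by
      have h1 : subvec (boundary G s) (observe ω) = subvec (boundary G s) ω :=
        subvec_boundary_observe_of_allObserved hω
      simp only [Pi.mul_apply, h1]) hQm
  obtain ⟨-, t3i⟩ := setIntegral_of_obsLaw_eq hg hC ht hQ (T := psiPatterns G a s)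
    (A := psiEvent G a s) rfl
    mr (fun ω hω => by
      have h1 : subvec (boundary G s) (observe ω) = subvec (boundary G s) ω :=
        subvec_boundary_observe_of_psiEvent has hω
      simp only [h1]) hm
  have hQint := (integrableOn_psiEvent_iff has hQM measurable_snd).2 t1
  refine ⟨(integrable_targetVar_iff Q).2 hQint, ?_⟩
  have e1 := setIntegral_psiEvent has hQM (h := Prod.snd) measurable_snd
  rw [← mu_eq_setIntegral] at e1
  have e2 := setIntegral_psiEvent has hQM (h := fun p => regression G a s P p.1)
    ((measurable_regression P).comp measurable_fst)
  have e3 := integral_eif_mul_score has hP hint hg hC hg0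
  rw [(integrable_leif_mul has hP hint hg' hC').2] at e3
  have i1 := integrable_mul_of_abs_le hQX hg' hC'
  have i2 := integrable_mul_of_abs_le hQm hg' hC'
  have i3 := integrable_mul_of_abs_le hOX hg' hC'
  have i4 := integrable_mul_of_abs_le hOm hg' hC'
  have i12 : IntegrableOn (fun ω => odds G a s Q (subvec (boundary G s) ω) * ω.1 a *
      g (observe ω) - odds G a s Q (subvec (boundary G s) ω) *
      regression G a s P (subvec (boundary G s) ω) * g (observe ω))
      (allObserved (closedNbhd G s)) (P : Measure (FullData d)) := i1.sub i2
  have i34 : IntegrableOn (fun ω => odds G a s P (subvec (boundary G s) ω) * ω.1 a *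
      g (observe ω) - odds G a s P (subvec (boundary G s) ω) *
      regression G a s P (subvec (boundary G s) ω) * g (observe ω))
      (allObserved (closedNbhd G s)) (P : Measure (FullData d)) := i3.sub i4
  have i5 : IntegrableOn (fun ω => 4 * |t| * C * C * |odds G a s P (subvec (boundary G s) ω) *
      ω.1 a - odds G a s P (subvec (boundary G s) ω) *
      regression G a s P (subvec (boundary G s) ω)|)
      (allObserved (closedNbhd G s)) (P : Measure (FullData d)) :=
    (hOX.sub hOm).abs.const_mul _
  -- the integrals of `O_s(Q) X_a` and `O_s(Q) m_s` under `P` cancel, as do those of `m_s`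
  -- under `Q` on the two events; the terms with a factor `t g` remain
  have key : mu G a s Q - mu G a s P - t * ∫ o, eif G a s P o * g o ∂(obsLaw P) =
      t * ∫ ω in allObserved (closedNbhd G s), ((odds G a s Q (subvec (boundary G s) ω) *
        ω.1 a * g (observe ω) - odds G a s Q (subvec (boundary G s) ω) *
        regression G a s P (subvec (boundary G s) ω) * g (observe ω)) -
        (odds G a s P (subvec (boundary G s) ω) * ω.1 a * g (observe ω) -
        odds G a s P (subvec (boundary G s) ω) *
        regression G a s P (subvec (boundary G s) ω) * g (observe ω)))
        ∂(P : Measure (FullData d)) := by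
    rw [integral_sub i12 i34, integral_sub i1 i2, integral_sub i3 i4, e3]
    simp only [Pi.mul_apply] at t1i t2i t3i e1 e2
    rw [t1i] at e1
    rw [t2i, t3i] at e2
    rw [hQmi, hmi] at e2
    rw [e1]
    linear_combination - e2
  rw [key, abs_mul]
  have hb : |∫ ω in allObserved (closedNbhd G s), ((odds G a s Q (subvec (boundary G s) ω) *
        ω.1 a * g (observe ω) - odds G a s Q (subvec (boundary G s) ω) *
        regression G a s P (subvec (boundary G s) ω) * g (observe ω)) -
        (odds G a s P (subvec (boundary G s) ω) * ω.1 a * g (observe ω) -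
        odds G a s P (subvec (boundary G s) ω) *
        regression G a s P (subvec (boundary G s) ω) * g (observe ω)))
        ∂(P : Measure (FullData d))| ≤ ∫ ω in allObserved (closedNbhd G s), 4 * |t| * C * C *
          |odds G a s P (subvec (boundary G s) ω) * ω.1 a - odds G a s P (subvec (boundary G s) ω) *
            regression G a s P (subvec (boundary G s) ω)| ∂(P : Measure (FullData d)) := by
    rw [← Real.norm_eq_abs]
    refine norm_integral_le_of_norm_le i5 ?_
    filter_upwards [hodds] with ω h
    have oP := odds_nonneg (G := G) (a := a) (s := s) P (subvec (boundary G s) ω)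
    rw [show odds G a s Q (subvec (boundary G s) ω) * ω.1 a * g (observe ω) -
        odds G a s Q (subvec (boundary G s) ω) *
        regression G a s P (subvec (boundary G s) ω) * g (observe ω) -
        (odds G a s P (subvec (boundary G s) ω) * ω.1 a * g (observe ω) -
        odds G a s P (subvec (boundary G s) ω) *
        regression G a s P (subvec (boundary G s) ω) * g (observe ω)) =
        (odds G a s Q (subvec (boundary G s) ω) - odds G a s P (subvec (boundary G s) ω)) *
          (ω.1 a - regression G a s P (subvec (boundary G s) ω)) * g (observe ω) by ring,
      ← mul_sub, norm_mul, norm_mul, abs_mul, abs_of_nonneg oP, Real.norm_eq_abs, Real.norm_eq_abs,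
      Real.norm_eq_abs]
    calc _ ≤ 4 * (|t| * C) * odds G a s P (subvec (boundary G s) ω) *
          |ω.1 a - regression G a s P (subvec (boundary G s) ω)| * C := by
          gcongr
          exact hC _
      _ = _ := by ring
  calc _ ≤ |t| * _ := mul_le_mul_of_nonneg_left hb (abs_nonneg t)
    _ = _ := by
      rw [integral_const_mul, ← sq_abs t]
      ring

theorem submodel_hasDerivAt (has : a ∈ s) (hP : P ∈ model G)
    (hint : Integrable (targetVar G a s) (P : Measure (FullData d)))
    {Q : ℝ → ProbabilityMeasure (FullData d)} (hQ : IsSubmodel (model G) P g Q) :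
    (∀ᶠ t in 𝓝 (0 : ℝ), Integrable (targetVar G a s) (Q t : Measure (FullData d))) ∧
      HasDerivAt (fun t => mu G a s (Q t)) (∫ o, eif G a s P o * g o ∂(obsLaw P)) 0 := by
  obtain ⟨C, hC⟩ := hQ.bounded_score
  have hsmall : ∀ᶠ t in 𝓝 (0 : ℝ), |t| * C ≤ 1 / 2 := by
    have : Tendsto (fun t : ℝ => |t| * C) (𝓝 0) (𝓝 (|0| * C)) :=
      (continuous_abs.mul continuous_const).tendsto 0
    rw [abs_zero, zero_mul] at this
    exact this.eventually (eventually_le_nhds (by norm_num))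
  have hall := (hsmall.and (hQ.mem_model.and hQ.obsLaw_eq)).mono fun t h =>
    abs_mu_sub_le has hP hint h.2.1 hQ.measurable_score hC hQ.score_mean h.1 h.2.2
  refine ⟨hall.mono fun t h => h.1, ?_⟩
  rw [hasDerivAt_iff_isLittleO_nhds_zero]
  have hO : (fun t : ℝ => mu G a s (Q (0 + t)) - mu G a s (Q 0) -
      t • ∫ o, eif G a s P o * g o ∂(obsLaw P)) =O[𝓝 0] fun t : ℝ => t ^ 2 := by
    refine Asymptotics.IsBigO.of_bound (4 * C * C *
      ∫ ω in allObserved (closedNbhd G s), |odds G a s P (subvec (boundary G s) ω) * ω.1 a -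
        odds G a s P (subvec (boundary G s) ω) * regression G a s P (subvec (boundary G s) ω)|
          ∂(P : Measure (FullData d))) ?_
    filter_upwards [hall] with t h
    rw [zero_add, hQ.base, Real.norm_eq_abs, Real.norm_of_nonneg (sq_nonneg t)]
    exact h.2
  exact hO.trans_isLittleO (Asymptotics.isLittleO_pow_id one_lt_two)

end Derivative

/-! ### Resampling of missing components -/

section Resample

variable {d : ℕ} {G : SimpleGraph (Fin d)}

/-- Replace the entries `X_s` of the full data by `y`. -/
def replaceEntries (s : Finset (Fin d)) (p : FullData d × (s → ℝ)) : FullData d :=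
  (fun j => if h : j ∈ s then p.2 ⟨j, h⟩ else p.1.1 j, p.1.2)

theorem measurable_replaceEntries (s : Finset (Fin d)) : Measurable (replaceEntries s) := by
  refine Measurable.prodMk (measurable_pi_lambda _ fun j => ?_) (by fun_prop)
  by_cases h : j ∈ s
  · simp only [h, dite_true]
    fun_prop
  · simp only [h, dite_false]
    fun_prop

theorem replaceEntries_fst_of_notMem {s : Finset (Fin d)} {j : Fin d} (hj : j ∉ s)
    (ω : FullData d) (y : s → ℝ) : (replaceEntries s (ω, y)).1 j = ω.1 j := by
  simp [replaceEntries, hj]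

theorem subvec_replaceEntries (s : Finset (Fin d)) (ω : FullData d) (y : s → ℝ) :
    subvec s (replaceEntries s (ω, y)) = y := by
  ext j
  simp [subvec, replaceEntries]

theorem subvec_replaceEntries_of_disjoint {s u : Finset (Fin d)} (h : Disjoint s u)
    (ω : FullData d) (y : s → ℝ) : subvec u (replaceEntries s (ω, y)) = subvec u ω := by
  ext j
  exact replaceEntries_fst_of_notMem (fun hj => Finset.disjoint_left.1 h hj j.2) ω y

/-- The law of the full data after `X_s` has been redrawn from the kernel `κ`, given `X_{N(s)}`. -/
noncomputable def resample (G : SimpleGraph (Fin d)) (s : Finset (Fin d))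
    (κ : Kernel (boundary G s → ℝ) (s → ℝ)) (μ : Measure (FullData d)) : Measure (FullData d) :=
  (μ ⊗ₘ κ.comap (subvec (boundary G s)) (measurable_subvec _)).map (replaceEntries s)

instance isFiniteMeasure_resample (s : Finset (Fin d)) (κ : Kernel (boundary G s → ℝ) (s → ℝ))
    (μ : Measure (FullData d)) [IsFiniteMeasure μ] [IsMarkovKernel κ] :
    IsFiniteMeasure (resample G s κ μ) := by
  unfold resample
  infer_instance

theorem lintegral_resample (s : Finset (Fin d)) (κ : Kernel (boundary G s → ℝ) (s → ℝ))
    [IsMarkovKernel κ] (μ : Measure (FullData d)) [IsFiniteMeasure μ] {h : FullData d → ℝ≥0∞}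
    (hh : Measurable h) : ∫⁻ ω, h ω ∂(resample G s κ μ) =
      ∫⁻ ω, ∫⁻ y, h (replaceEntries s (ω, y)) ∂(κ (subvec (boundary G s) ω)) ∂μ := by
  rw [resample, lintegral_map hh (measurable_replaceEntries s),
    Measure.lintegral_compProd (f := fun p => h (replaceEntries s p))
      (hh.comp (measurable_replaceEntries s))]
  rfl

/-- The law of the full data after the vertex sets in a list have been resampled one after the
other. -/
noncomputable def resampleList (G : SimpleGraph (Fin d))
    (κ : ∀ s : Finset (Fin d), Kernel (boundary G s → ℝ) (s → ℝ)) (μ : Measure (FullData d)) :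
    List (Finset (Fin d)) → Measure (FullData d)
  | [] => μ
  | s :: L => resample G s (κ s) (resampleList G κ μ L)

instance isFiniteMeasure_resampleList
    (κ : ∀ s : Finset (Fin d), Kernel (boundary G s → ℝ) (s → ℝ)) [∀ s, IsMarkovKernel (κ s)]
    (μ : Measure (FullData d)) [IsFiniteMeasure μ] (L : List (Finset (Fin d))) :
    IsFiniteMeasure (resampleList G κ μ L) := by
  induction L with
  | nil => exact ‹IsFiniteMeasure μ›
  | cons s L ih =>
    unfold resampleList
    infer_instance

/-- `h` depends on the full data only through the pattern and the entries observed under `r`. -/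
def DependsOnObserved (r : Pattern d) (h : FullData d → ℝ≥0∞) : Prop :=
  ∀ ω ω' : FullData d, ω.2 = ω'.2 → (∀ j, r j = true → ω.1 j = ω'.1 j) → h ω = h ω'

theorem DependsOnObserved.mul {r : Pattern d} {h k : FullData d → ℝ≥0∞}
    (hh : DependsOnObserved r h) (hk : DependsOnObserved r k) :
    DependsOnObserved r fun ω => h ω * k ω := fun ω ω' h1 h2 => by
  simp only [hh ω ω' h1 h2, hk ω ω' h1 h2]

theorem dependsOnObserved_comp_subvec {r : Pattern d} {S : Finset (Fin d)}
    (hS : ∀ j ∈ S, r j = true) (f : (S → ℝ) → ℝ≥0∞) :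
    DependsOnObserved r fun ω => f (subvec S ω) := fun ω ω' _ h2 => by
  have : subvec S ω = subvec S ω' := funext fun j => h2 j (hS j j.2)
  simp only [this]

/-- Disjoint missing vertex sets whose boundaries are observed are, after resampling, conditionally
independent given the observed entries, with the prescribed conditional laws. -/
theorem lintegral_resampleList {r : Pattern d}
    (κ : ∀ s : Finset (Fin d), Kernel (boundary G s → ℝ) (s → ℝ)) [∀ s, IsMarkovKernel (κ s)]
    (μ : Measure (FullData d)) [IsFiniteMeasure μ]
    {B : ∀ s : Finset (Fin d), Set (s → ℝ)} (hB : ∀ s, MeasurableSet (B s))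
    (L : List (Finset (Fin d))) (hdisj : L.Pairwise Disjoint)
    (hmiss : ∀ s ∈ L, ∀ j ∈ s, r j = false) (hobs : ∀ s ∈ L, ∀ j ∈ boundary G s, r j = true)
    {h : FullData d → ℝ≥0∞} (hh : Measurable h) (hr : DependsOnObserved r h) :
    ∫⁻ ω, h ω * (L.map fun s => (B s).indicator (fun _ => (1 : ℝ≥0∞)) (subvec s ω)).prod
        ∂(resampleList G κ μ L) =
      ∫⁻ ω, h ω * (L.map fun s => κ s (subvec (boundary G s) ω) (B s)).prod ∂μ := by
  induction L generalizing h with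
  | nil => simp [resampleList]
  | cons s L ih =>
    have hdisj' := List.pairwise_cons.1 hdisj
    have hind : ∀ u, Measurable fun ω : FullData d =>
        (B u).indicator (fun _ => (1 : ℝ≥0∞)) (subvec u ω) := fun u =>
      (measurable_const.indicator (hB u)).comp (measurable_subvec u)
    have hprod : Measurable fun ω : FullData d =>
        (L.map fun u => (B u).indicator (fun _ => (1 : ℝ≥0∞)) (subvec u ω)).prod := by
      clear ih hdisj hmiss hobs hdisj'
      induction L with
      | nil => simp
      | cons u L ih =>
        simp only [List.map_cons, List.prod_cons]
        exact (hind u).mul ih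
    have hκ : Measurable fun ω : FullData d => κ s (subvec (boundary G s) ω) (B s) :=
      (Kernel.measurable_coe (κ s) (hB s)).comp (measurable_subvec _)
    have hs := hmiss s (by simp)
    have hrep : ∀ ω y, h (replaceEntries s (ω, y)) = h ω := fun ω y =>
      hr _ _ rfl fun j hj => replaceEntries_fst_of_notMem (fun hjs => by simp [hs j hjs] at hj) ω y
    have hrepL : ∀ (ω : FullData d) (y : s → ℝ), (L.map fun u => (B u).indicator
        (fun _ => (1 : ℝ≥0∞)) (subvec u (replaceEntries s (ω, y)))) =
        L.map fun u => (B u).indicator (fun _ => (1 : ℝ≥0∞)) (subvec u ω) := fun ω y =>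
      List.map_congr_left fun u hu => by
        rw [subvec_replaceEntries_of_disjoint (hdisj'.1 u hu)]
    rw [resampleList]
    simp only [List.map_cons, List.prod_cons]
    have hm : Measurable fun ω => h ω * ((B s).indicator (fun _ => (1 : ℝ≥0∞)) (subvec s ω) *
        (L.map fun u => (B u).indicator (fun _ => (1 : ℝ≥0∞)) (subvec u ω)).prod) :=
      hh.mul ((hind s).mul hprod)
    rw [lintegral_resample s (κ s) _ hm]
    simp only [hrep, hrepL, subvec_replaceEntries]
    -- the factor of the resampled set is itself observed, so it can be moved into `h`
    calc _ = ∫⁻ ω, (h ω * κ s (subvec (boundary G s) ω) (B s)) *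
          (L.map fun u => (B u).indicator (fun _ => (1 : ℝ≥0∞)) (subvec u ω)).prod
            ∂(resampleList G κ μ L) := by
          refine lintegral_congr fun ω => ?_
          rw [lintegral_const_mul _ ((measurable_const.indicator (hB s)).mul_const _),
            lintegral_mul_const _ (measurable_const.indicator (hB s)), lintegral_indicator (hB s)]
          simp [mul_assoc]
      _ = _ := by
          rw [ih hdisj'.2 (fun u hu => hmiss u (by simp [hu])) (fun u hu => hobs u (by simp [hu]))
            (h := fun ω => h ω * κ s (subvec (boundary G s) ω) (B s)) (hh.mul hκ)
            (hr.mul (dependsOnObserved_comp_subvec (hobs s (by simp)) fun z => κ s z (B s)))]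
          simp only [mul_assoc]

end Resample

/-! ### A law of the model with given observed-data law -/

section Imputation

variable {d : ℕ} {G : SimpleGraph (Fin d)}

theorem sum_restrict_patternEq (μ : Measure (FullData d)) :
    (Measure.sum fun r : Pattern d => μ.restrict (patternEq r)) = μ := by
  have h : (⋃ r : Pattern d, patternEq r) = (Set.univ : Set (FullData d)) := by
    ext ω
    simp [patternEq]
  rw [← Measure.restrict_iUnion _ measurableSet_patternEq, h, Measure.restrict_univ]
  exact fun r r' hr => Set.disjoint_left.2 fun ω (h1 : ω.2 = r) (h2 : ω.2 = r') =>
    hr (h1.symm.trans h2)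

/-- The part on `{R = r}` of the imputed law: every component of the missing variables is drawn,
given its boundary, from the conditional law under `O` on the event that it is observed
together with its boundary. -/
noncomputable def imputedPart (G : SimpleGraph (Fin d)) (O : Measure (FullData d))
    [IsFiniteMeasure O] (r : Pattern d) : Measure (FullData d) :=
  resampleList G (fun s => condDistrib (subvec s) (subvec (boundary G s))
    (O.restrict (allObserved (closedNbhd G s)))) (O.restrict (patternEq r))
    (components G (ones (revPattern r))).toList

/-- The full-data law that fills in the missing entries of the observed-data law `O` so that the
result obeys the Markov property and the principle of available information. -/
noncomputable def imputedLaw (G : SimpleGraph (Fin d)) (O : Measure (FullData d))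
    [IsFiniteMeasure O] : Measure (FullData d) :=
  Measure.sum fun r => imputedPart G O r

variable {O : Measure (FullData d)} [IsFiniteMeasure O]

instance isFiniteMeasure_imputedPart (r : Pattern d) : IsFiniteMeasure (imputedPart G O r) := by
  unfold imputedPart
  infer_instance

/-- Under the imputed law the components of the missing variables are conditionally independent
given the observed entries, with the imputation kernels as conditional laws. -/
theorem lintegral_imputedPart_mul_prod (r : Pattern d) {B : ∀ s : Finset (Fin d), Set (s → ℝ)}
    (hB : ∀ s, MeasurableSet (B s)) {h : FullData d → ℝ≥0∞} (hh : Measurable h)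
    (hr : DependsOnObserved r h) :
    ∫⁻ ω, h ω * ∏ s ∈ components G (ones (revPattern r)),
        (B s).indicator (fun _ => (1 : ℝ≥0∞)) (subvec s ω) ∂(imputedPart G O r) =
      ∫⁻ ω in patternEq r, h ω * ∏ s ∈ components G (ones (revPattern r)),
        condDistrib (subvec s) (subvec (boundary G s))
          (O.restrict (allObserved (closedNbhd G s))) (subvec (boundary G s) ω) (B s) ∂O := by
  have := lintegral_resampleList (G := G) (fun s => condDistrib (subvec s) (subvec (boundary G s))
    (O.restrict (allObserved (closedNbhd G s)))) (O.restrict (patternEq r)) hB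
    (components G (ones (revPattern r))).toList
    ((Finset.nodup_toList _).pairwise_of_forall_ne fun s hs t ht hst =>
      disjoint_of_mem_components (Finset.mem_toList.1 hs) (Finset.mem_toList.1 ht) hst)
    (fun s hs j hj => eq_false_of_mem_components (Finset.mem_toList.1 hs) hj)
    (fun s hs j hj => eq_true_of_mem_boundary (Finset.mem_toList.1 hs) hj) hh hr
  simp only [Finset.prod_map_toList] at this
  exact this

theorem lintegral_imputedPart (r : Pattern d) {h : FullData d → ℝ≥0∞} (hh : Measurable h)
    (hr : DependsOnObserved r h) :
    ∫⁻ ω, h ω ∂(imputedPart G O r) = ∫⁻ ω in patternEq r, h ω ∂O := by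
  have := lintegral_imputedPart_mul_prod (G := G) (O := O) r (B := fun _ => Set.univ)
    (fun _ => MeasurableSet.univ) hh hr
  simpa using this

theorem imputedPart_compl_patternEq (r : Pattern d) :
    imputedPart G O r (patternEq r)ᶜ = 0 := by
  have hm := (measurableSet_patternEq r).compl
  have h := lintegral_imputedPart (G := G) (O := O) r
    (h := (patternEq r)ᶜ.indicator fun _ => 1) (measurable_const.indicator hm)
    (fun ω ω' h _ => by simp [Set.indicator, patternEq, h])
  rw [lintegral_indicator_const hm, lintegral_indicator_const hm, one_mul, one_mul,
    Measure.restrict_apply hm] at h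
  rw [h]
  simp

theorem imputedLaw_restrict_patternEq (r : Pattern d) :
    (imputedLaw G O).restrict (patternEq r) = imputedPart G O r := by
  have h1 : ∀ r' : Pattern d, r' ≠ r → (imputedPart G O r').restrict (patternEq r) = 0 := by
    intro r' hr'
    rw [Measure.restrict_eq_zero]
    refine measure_mono_null (fun ω (hω : ω.2 = r) => ?_) (imputedPart_compl_patternEq r')
    exact fun hω' : ω.2 = r' => hr' (hω'.symm.trans hω)
  have h2 : (imputedPart G O r).restrict (patternEq r) = imputedPart G O r :=
    Measure.restrict_eq_self_of_ae_mem (mem_ae_iff.2 (imputedPart_compl_patternEq r))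
  ext A hA
  rw [imputedLaw, Measure.restrict_sum _ (measurableSet_patternEq r), Measure.sum_apply _ hA,
    tsum_eq_single r fun r' hr' => by rw [h1 r' hr']; simp, h2]

/-- Imputation does not change the observed data. -/
theorem imputedLaw_map_observe (hO : O.map observe = O) : (imputedLaw G O).map observe = O := by
  ext A hA
  have hA' := measurable_observe hA
  conv_rhs => rw [← hO, ← sum_restrict_patternEq O]
  rw [Measure.map_apply measurable_observe hA, Measure.map_apply measurable_observe hA, imputedLaw,
    Measure.sum_apply _ hA', Measure.sum_apply _ hA']
  refine tsum_congr fun r => ?_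
  have hm := hA'.inter (measurableSet_patternEq r)
  have h := lintegral_imputedPart (G := G) (O := O) r
    (h := (observe ⁻¹' A ∩ patternEq r).indicator fun _ => 1) (measurable_const.indicator hm)
    (fun ω ω' h1 h2 => by
      by_cases hr : ω'.2 = r
      · have : observe ω = observe ω' := by
          refine Prod.ext (funext fun j => ?_) h1
          by_cases hj : r j = true
          · rw [observe_fst_of_eq_true (by rw [h1, hr, hj]),
              observe_fst_of_eq_true (by rw [hr, hj]), h2 j hj]
          · simp [observe, h1, hr, hj]
        have e : ω ∈ observe ⁻¹' A ∩ patternEq r ↔ ω' ∈ observe ⁻¹' A ∩ patternEq r := by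
          simp only [Set.mem_inter_iff, Set.mem_preimage, patternEq, Set.mem_ofPred_eq, h1, this]
        by_cases h : ω ∈ observe ⁻¹' A ∩ patternEq r
        · rw [Set.indicator_of_mem h, Set.indicator_of_mem (e.1 h)]
        · rw [Set.indicator_of_notMem h, Set.indicator_of_notMem (h ∘ e.2)]
      · simp [Set.indicator, patternEq, h1, hr])
  rw [lintegral_indicator_const hm, lintegral_indicator_const hm, one_mul, one_mul,
    Measure.restrict_apply hm, Set.inter_assoc, Set.inter_self,
    measure_inter_conull' ?_] at h
  · rw [h, Measure.restrict_apply hA']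
  · refine measure_mono_null ?_ (imputedPart_compl_patternEq r)
    exact fun ω hω => hω.2

/-- Under the imputed law, a missing component is drawn from the kernel it was imputed from. -/
theorem imputedPart_map_eq_compProd {r : Pattern d} {s : Finset (Fin d)}
    (hs : s ∈ components G (ones (revPattern r))) :
    (imputedPart G O r).map (fun ω => (subvec (boundary G s) ω, subvec s ω)) =
      ((imputedPart G O r).map (subvec (boundary G s))) ⊗ₘ
        condDistrib (subvec s) (subvec (boundary G s))
          (O.restrict (allObserved (closedNbhd G s))) := by
  classical
  have hN := measurable_subvec (boundary G s)
  have hsm := measurable_subvec s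
  refine Measure.ext_prod fun {A B} hA hB => ?_
  have hκ := Kernel.measurable_coe (condDistrib (subvec s) (subvec (boundary G s))
    (O.restrict (allObserved (closedNbhd G s)))) hB
  -- no condition on the components other than `s`
  set B' : ∀ t : Finset (Fin d), Set (t → ℝ) := Function.update (fun _ => Set.univ) s B with hB'
  have hB's : B' s = B := by simp [hB']
  have hB't : ∀ t, t ≠ s → B' t = Set.univ := fun t ht => by simp [hB', ht]
  have hB'm : ∀ t, MeasurableSet (B' t) := fun t => by
    by_cases ht : t = s
    · subst ht
      rwa [hB's]
    · rw [hB't t ht]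
      exact MeasurableSet.univ
  have hAm : Measurable fun ω : FullData d =>
      A.indicator (fun _ => (1 : ℝ≥0∞)) (subvec (boundary G s) ω) :=
    (measurable_const.indicator hA).comp hN
  have hobs : ∀ j ∈ boundary G s, r j = true := fun j hj => eq_true_of_mem_boundary hs hj
  have hAr := dependsOnObserved_comp_subvec hobs (A.indicator fun _ => (1 : ℝ≥0∞))
  have h1 := lintegral_imputedPart_mul_prod (G := G) (O := O) r hB'm hAm hAr
  have h2 := lintegral_imputedPart (G := G) (O := O) r (hAm.mul (hκ.comp hN))
    (hAr.mul (dependsOnObserved_comp_subvec hobs fun z => condDistrib (subvec s)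
      (subvec (boundary G s)) (O.restrict (allObserved (closedNbhd G s))) z B))
  have e1 : ∀ ω : FullData d, ∏ t ∈ components G (ones (revPattern r)),
      (B' t).indicator (fun _ => (1 : ℝ≥0∞)) (subvec t ω) =
        B.indicator (fun _ => (1 : ℝ≥0∞)) (subvec s ω) := fun ω => by
    rw [Finset.prod_eq_single_of_mem s hs fun t _ ht => by simp [hB't t ht], hB's]
  have e2 : ∀ ω : FullData d, ∏ t ∈ components G (ones (revPattern r)),
      condDistrib (subvec t) (subvec (boundary G t))
        (O.restrict (allObserved (closedNbhd G t))) (subvec (boundary G t) ω) (B' t) =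
      condDistrib (subvec s) (subvec (boundary G s))
        (O.restrict (allObserved (closedNbhd G s))) (subvec (boundary G s) ω) B := fun ω => by
    rw [Finset.prod_eq_single_of_mem s hs fun t _ ht => by simp [hB't t ht], hB's]
  simp only [e1, e2] at h1
  rw [Measure.map_apply (hN.prodMk hsm) (hA.prod hB), Measure.compProd_apply_prod hA hB,
    setLIntegral_map hA hκ hN, ← lintegral_indicator (hN hA)]
  have e3 : (imputedPart G O r) ((fun ω => (subvec (boundary G s) ω, subvec s ω)) ⁻¹' A ×ˢ B) =
      ∫⁻ ω, A.indicator (fun _ => (1 : ℝ≥0∞)) (subvec (boundary G s) ω) *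
        B.indicator (fun _ => (1 : ℝ≥0∞)) (subvec s ω) ∂(imputedPart G O r) := by
    rw [← lintegral_indicator_one ((hN.prodMk hsm) (hA.prod hB))]
    refine lintegral_congr fun ω => ?_
    by_cases h1 : subvec (boundary G s) ω ∈ A <;> by_cases h2 : subvec s ω ∈ B <;>
      simp [Set.indicator, h1, h2]
  rw [e3, h1]
  refine Eq.trans h2.symm (lintegral_congr fun ω => ?_)
  by_cases h1 : subvec (boundary G s) ω ∈ A <;> simp [Set.indicator, h1]

end Imputation

section Existence

variable {d : ℕ} {G : SimpleGraph (Fin d)} {O : Measure (FullData d)} [IsFiniteMeasure O]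

theorem condDistrib_imputedPart_ae_eq {r : Pattern d} {s : Finset (Fin d)}
    (hs : s ∈ components G (ones (revPattern r))) :
    condDistrib (subvec s) (subvec (boundary G s)) (imputedPart G O r)
      =ᵐ[(imputedPart G O r).map (subvec (boundary G s))]
    condDistrib (subvec s) (subvec (boundary G s))
      (O.restrict (allObserved (closedNbhd G s))) :=
  condDistrib_ae_eq_of_measure_eq_compProd _ (measurable_subvec s).aemeasurable
    (imputedPart_map_eq_compProd hs)

/-- The full data with pattern `r` that agree with `z` on the entries observed under `r` and vanish
elsewhere. -/
def extendByZero (r : Pattern d) (z : ones r → ℝ) : FullData d :=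
  (fun j => if h : j ∈ ones r then z ⟨j, h⟩ else 0, r)

theorem measurable_extendByZero (r : Pattern d) : Measurable (extendByZero r) := by
  refine Measurable.prodMk (measurable_pi_lambda _ fun j => ?_) measurable_const
  by_cases h : j ∈ ones r
  · simp only [h, dite_true]
    fun_prop
  · simp only [h, dite_false]
    fun_prop

theorem subvec_extendByZero {r : Pattern d} {S : Finset (Fin d)} (hS : ∀ j ∈ S, r j = true)
    (ω : FullData d) : subvec S (extendByZero r (subvec (ones r) ω)) = subvec S ω := by
  ext j
  have : (j : Fin d) ∈ ones r := mem_ones.2 (hS j j.2)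
  simp [subvec, extendByZero, this]

/-- The Markov property of the imputed law on `{R = r}`. -/
theorem markov_imputedPart (r : Pattern d) {B : ∀ s : Finset (Fin d), Set (s → ℝ)}
    (hB : ∀ s, MeasurableSet (B s)) :
    ∀ᵐ ω ∂(imputedPart G O r),
      condDistrib (fun ω' : FullData d => ω'.1) (subvec (ones r)) (imputedPart G O r)
          (subvec (ones r) ω)
          {y | ∀ s ∈ components G (ones (revPattern r)), (fun j : s => y j) ∈ B s}
        = ∏ s ∈ components G (ones (revPattern r)),
            condDistrib (subvec s) (subvec (boundary G s)) (imputedPart G O r)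
              (subvec (boundary G s) ω) (B s) := by
  set ρ := imputedPart G O r
  set 𝒞 := components G (ones (revPattern r))
  have hobs : ∀ s ∈ 𝒞, ∀ j ∈ boundary G s, r j = true := fun s hs j hj =>
    eq_true_of_mem_boundary hs hj
  have hX : Measurable (subvec (d := d) (ones r)) := measurable_subvec _
  have hS : MeasurableSet {y : Fin d → ℝ | ∀ s ∈ 𝒞, (fun j : s => y j) ∈ B s} := by
    have : {y : Fin d → ℝ | ∀ s ∈ 𝒞, (fun j : s => y j) ∈ B s} =
        ⋂ s ∈ 𝒞, (fun y (j : s) => y j) ⁻¹' B s := by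
      ext y
      simp
    rw [this]
    exact Finset.measurableSet_biInter _ fun s _ =>
      (measurable_pi_lambda _ fun j => measurable_pi_apply _) (hB s)
  -- the product of the imputation kernels, as a function of all data and of the observed entries
  set K : FullData d → ℝ≥0∞ := fun ω => ∏ s ∈ 𝒞, condDistrib (subvec s) (subvec (boundary G s))
    (O.restrict (allObserved (closedNbhd G s))) (subvec (boundary G s) ω) (B s) with hK
  have hKm : Measurable K := Finset.measurable_fun_prod _ fun s _ =>
    (Kernel.measurable_coe _ (hB s)).comp (measurable_subvec _)
  have hKe : ∀ ω, K (extendByZero r (subvec (ones r) ω)) = K ω := fun ω =>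
    Finset.prod_congr rfl fun s hs => by rw [subvec_extendByZero (hobs s hs)]
  have hKr : DependsOnObserved r K := fun ω ω' _ h2 =>
    Finset.prod_congr rfl fun s hs => by
      have : subvec (boundary G s) ω = subvec (boundary G s) ω' :=
        funext fun j => h2 j (hobs s hs j j.2)
      rw [this]
  have h1 : ∀ᵐ ω ∂ρ, ∏ s ∈ 𝒞, condDistrib (subvec s) (subvec (boundary G s)) ρ
      (subvec (boundary G s) ω) (B s) = K ω := by
    have : ∀ᵐ ω ∂ρ, ∀ s ∈ 𝒞, condDistrib (subvec s) (subvec (boundary G s)) ρ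
        (subvec (boundary G s) ω) = condDistrib (subvec s) (subvec (boundary G s))
        (O.restrict (allObserved (closedNbhd G s))) (subvec (boundary G s) ω) :=
      (Finset.eventually_all 𝒞).2 fun s hs => ae_of_ae_map (measurable_subvec _).aemeasurable
        (condDistrib_imputedPart_ae_eq hs)
    filter_upwards [this] with ω hω
    exact Finset.prod_congr rfl fun s hs => by rw [hω s hs]
  have h2 : ∀ᵐ z ∂(ρ.map (subvec (ones r))),
      condDistrib (fun ω' : FullData d => ω'.1) (subvec (ones r)) ρ z
        {y | ∀ s ∈ 𝒞, (fun j : s => y j) ∈ B s} = K (extendByZero r z) := by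
    have hF := Kernel.measurable_coe
      (condDistrib (fun ω' : FullData d => ω'.1) (subvec (ones r)) ρ) hS
    have hK' : Measurable fun z => K (extendByZero r z) :=
      hKm.comp (measurable_extendByZero r)
    refine ae_eq_of_forall_setLIntegral_eq_of_sigmaFinite hF hK' fun A hA _ => ?_
    have hAm : Measurable fun ω : FullData d =>
        A.indicator (fun _ => (1 : ℝ≥0∞)) (subvec (ones r) ω) :=
      (measurable_const.indicator hA).comp hX
    have hAr : DependsOnObserved r fun ω : FullData d =>
        A.indicator (fun _ => (1 : ℝ≥0∞)) (subvec (ones r) ω) :=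
      dependsOnObserved_comp_subvec (fun j hj => mem_ones.1 hj) _
    have e1 := lintegral_imputedPart_mul_prod (G := G) (O := O) r hB hAm hAr
    have e2 := lintegral_imputedPart (G := G) (O := O) r (hAm.mul hKm) (hAr.mul hKr)
    rw [setLIntegral_map hA hF hX, setLIntegral_map hA hK' hX,
      setLIntegral_preimage_condDistrib hX measurable_fst.aemeasurable hS hA]
    have e3 : ∫⁻ ω in subvec (ones r) ⁻¹' A, K (extendByZero r (subvec (ones r) ω)) ∂ρ =
        ∫⁻ ω, A.indicator (fun _ => (1 : ℝ≥0∞)) (subvec (ones r) ω) * K ω ∂ρ := by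
      rw [← lintegral_indicator (hX hA)]
      refine lintegral_congr fun ω => ?_
      by_cases h : subvec (ones r) ω ∈ A <;> simp [Set.indicator, h, hKe]
    rw [e3]
    refine Eq.trans ?_ (e1.trans e2.symm)
    rw [← lintegral_indicator_one ((hX hA).inter (measurable_fst hS))]
    refine lintegral_congr fun ω => ?_
    by_cases h : subvec (ones r) ω ∈ A
    · by_cases h' : ∀ s ∈ 𝒞, subvec s ω ∈ B s
      · have e : ∏ s ∈ 𝒞, (B s).indicator (fun _ => (1 : ℝ≥0∞)) (subvec s ω) = 1 :=
          Finset.prod_eq_one fun s hs => by simp [h' s hs]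
        have hm : ω ∈ subvec (ones r) ⁻¹' A ∩
            Prod.fst ⁻¹' {y : Fin d → ℝ | ∀ s ∈ 𝒞, (fun j : s => y j) ∈ B s} := ⟨h, h'⟩
        rw [e, Set.indicator_of_mem hm, Set.indicator_of_mem h]
        simp
      · have hm : ω ∉ subvec (ones r) ⁻¹' A ∩
            Prod.fst ⁻¹' {y : Fin d → ℝ | ∀ s ∈ 𝒞, (fun j : s => y j) ∈ B s} :=
          fun hm => h' hm.2
        push Not at h'
        obtain ⟨s, hs, hsB⟩ := h'
        rw [Set.indicator_of_notMem hm, Finset.prod_eq_zero hs (by simp [hsB]), mul_zero]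
    · have hm : ω ∉ subvec (ones r) ⁻¹' A ∩
          Prod.fst ⁻¹' {y : Fin d → ℝ | ∀ s ∈ 𝒞, (fun j : s => y j) ∈ B s} := fun hm => h hm.1
      rw [Set.indicator_of_notMem hm, Set.indicator_of_notMem h, zero_mul]
  filter_upwards [h1, ae_of_ae_map hX.aemeasurable h2] with ω hω1 hω2
  rw [hω1, hω2, hKe]

/-- The model is nonparametric: it puts no restriction on the observed-data law beyond overlap.
The condition on `O.map observe` says that missing entries are recorded as `0`. -/
theorem exists_mem_model_obsLaw_eq (G : SimpleGraph (Fin d)) (O : Measure (FullData d))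
    [IsProbabilityMeasure O] (hO : O.map observe = O)
    (hoverlap : ∀ r : Pattern d, ∀ s ∈ components G (ones (revPattern r)),
      (O.restrict (patternEq r)).map (subvec (boundary G s)) ≪
        (O.restrict (allObserved (closedNbhd G s))).map (subvec (boundary G s))) :
    ∃ Q ∈ model G, obsLaw Q = O := by
  have hmap := imputedLaw_map_observe (G := G) hO
  have hprob : IsProbabilityMeasure (imputedLaw G O) := by
    refine ⟨?_⟩
    have : (imputedLaw G O).map observe Set.univ = 1 := by
      rw [hmap]
      exact measure_univ
    rwa [Measure.map_apply measurable_observe MeasurableSet.univ, Set.preimage_univ] at this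
  let Q : ProbabilityMeasure (FullData d) := ⟨imputedLaw G O, hprob⟩
  have hQ : obsLaw Q = O := hmap
  have hQr : ∀ r, (Q : Measure (FullData d)).restrict (patternEq r) = imputedPart G O r :=
    imputedLaw_restrict_patternEq
  refine ⟨Q, ⟨?_, ?_⟩, hQ⟩
  · intro r B hB
    simp only [hQr]
    exact markov_imputedPart r hB
  · intro r s hs
    have hN := measurable_subvec (boundary G s)
    have hsm := measurable_subvec s
    have eE := map_restrict_obsLaw Q (T := patternsGE (closedNbhd G s)) (hN.prodMk hsm)
      fun ω hω => by
        rw [subvec_boundary_observe_of_allObserved (G := G) (s := s) hω,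
          subvec_observe_of_allObserved (G := G) (s := s) hω]
    have eEN := map_restrict_obsLaw_allObserved (G := G) (s := s) Q
    have eR : ((obsLaw Q).restrict (patternEq r)).map (subvec (boundary G s)) =
        ((Q : Measure (FullData d)).restrict (patternEq r)).map (subvec (boundary G s)) :=
      map_restrict_obsLaw Q (T := {r}) hN fun ω hω => subvec_boundary_observe_of_components hs hω
    rw [hQ] at eE eEN eR
    have hac := hoverlap r s hs
    rw [eEN, eR] at hac
    refine ⟨hac, ?_⟩
    have hE : condDistrib (subvec s) (subvec (boundary G s))
        ((Q : Measure (FullData d)).restrict (allObserved (closedNbhd G s)))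
        =ᵐ[((Q : Measure (FullData d)).restrict (allObserved (closedNbhd G s))).map
          (subvec (boundary G s))]
        condDistrib (subvec s) (subvec (boundary G s))
          (O.restrict (allObserved (closedNbhd G s))) := by
      refine condDistrib_ae_eq_of_measure_eq_compProd _ hsm.aemeasurable ?_
      rw [← eEN, compProd_map_condDistrib hsm.aemeasurable]
      exact eE.symm
    have hR : condDistrib (subvec s) (subvec (boundary G s))
        ((Q : Measure (FullData d)).restrict (patternEq r))
        =ᵐ[((Q : Measure (FullData d)).restrict (patternEq r)).map (subvec (boundary G s))]
        condDistrib (subvec s) (subvec (boundary G s))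
          (O.restrict (allObserved (closedNbhd G s))) := by
      simp only [hQr]
      exact condDistrib_imputedPart_ae_eq hs
    exact hR.trans (Filter.EventuallyEq.symm (hac.ae_le hE))

/-! ### Bounded mean-zero functions are scores -/

theorem observe_observe (ω : FullData d) : observe (observe ω) = observe ω := by
  refine Prod.ext (funext fun j => ?_) rfl
  by_cases h : ω.2 j = true <;> simp [observe, h]

/-- Every bounded mean-zero function of the observed data is a score. -/
theorem exists_isSubmodel {P : ProbabilityMeasure (FullData d)} (hP : P ∈ model G)
    {g : FullData d → ℝ} (hg : Measurable g) {C : ℝ} (hC : ∀ o, |g o| ≤ C)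
    (hg0 : ∫ o, g o ∂(obsLaw P) = 0) :
    ∃ Q, IsSubmodel (model G) P g Q := by
  have hgi : Integrable g (obsLaw P) :=
    Integrable.of_bound hg.aestronglyMeasurable C (ae_of_all _ hC)
  have main : ∀ t : ℝ, |t| * C ≤ 1 / 2 → ∃ Q ∈ model G,
      obsLaw Q = (obsLaw P).withDensity fun o => ENNReal.ofReal (1 + t * g o) := by
    intro t ht
    have hpos : ∀ o, 0 < 1 + t * g o := fun o => by linarith [half_le_one_add_mul hC ht o]
    have hd : Measurable fun o => ENNReal.ofReal (1 + t * g o) := by fun_prop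
    set O := (obsLaw P).withDensity fun o => ENNReal.ofReal (1 + t * g o) with hO
    have hac1 : O ≪ obsLaw P := withDensity_absolutelyContinuous _ _
    have hac2 : obsLaw P ≪ O := withDensity_absolutelyContinuous' hd.aemeasurable
      (ae_of_all _ fun o => (ENNReal.ofReal_pos.2 (hpos o)).ne')
    have hprob : IsProbabilityMeasure O := by
      refine ⟨?_⟩
      have hi : Integrable (fun o => 1 + t * g o) (obsLaw P) :=
        (integrable_const _).add (hgi.const_mul t)
      rw [hO, withDensity_apply _ MeasurableSet.univ, Measure.restrict_univ,
        ← ofReal_integral_eq_lintegral_ofReal hi (ae_of_all _ fun o => (hpos o).le),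
        integral_add (integrable_const _) (hgi.const_mul t), integral_const_mul, hg0]
      simp
    have hobs : O.map observe = O := by
      have h1 : ∀ᵐ o ∂(obsLaw P), observe o = o := by
        rw [obsLaw, ae_map_iff measurable_observe.aemeasurable
          (measurableSet_eq_fun (g := fun o => o) measurable_observe measurable_id)]
        exact ae_of_all _ observe_observe
      rw [Measure.map_congr (hac1.ae_le h1 : observe =ᵐ[O] id), Measure.map_id]
    refine exists_mem_model_obsLaw_eq G O hobs fun r s hs => ?_
    have hN := measurable_subvec (boundary G s)
    have eR : ((obsLaw P).restrict (patternEq r)).map (subvec (boundary G s)) =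
        ((P : Measure (FullData d)).restrict (patternEq r)).map (subvec (boundary G s)) :=
      map_restrict_obsLaw P (T := {r}) hN fun ω hω => subvec_boundary_observe_of_components hs hω
    have h := (hP.2 r s hs).1
    rw [← eR, ← map_restrict_obsLaw_allObserved] at h
    exact (((hac1.restrict _).map hN).trans h).trans ((hac2.restrict _).map hN)
  choose! Q hQM hQO using main
  have hsmall : ∀ᶠ t in 𝓝 (0 : ℝ), |t| * C ≤ 1 / 2 := by
    have : Tendsto (fun t : ℝ => |t| * C) (𝓝 0) (𝓝 (|0| * C)) :=
      (continuous_abs.mul continuous_const).tendsto 0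
    rw [abs_zero, zero_mul] at this
    exact this.eventually (eventually_le_nhds (by norm_num))
  -- the base point has to be `P` itself, not the imputed law with the same observed data
  refine ⟨Function.update Q 0 P, hg, ⟨C, hC⟩, hg0, by simp, ?_, ?_⟩
  · filter_upwards [hsmall] with t ht
    by_cases h : t = 0
    · subst h
      simpa using hP
    · rw [Function.update_of_ne h]
      exact hQM t ht
  · filter_upwards [hsmall] with t ht
    by_cases h : t = 0
    · subst h
      simp only [Function.update_self, zero_mul, add_zero, ENNReal.ofReal_one]
      exact (withDensity_one).symm
    · rw [Function.update_of_ne h]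
      exact hQO t ht

end Existence

/-! ### The tangent space -/

section Tangent

/-- An integrable function that is orthogonal to all bounded functions of mean zero is constant. -/
theorem ae_eq_integral_of_forall_integral_mul_eq_zero {Ω : Type*} [MeasurableSpace Ω]
    {μ : Measure Ω} [IsProbabilityMeasure μ] {h : Ω → ℝ} (hh : Integrable h μ)
    (H : ∀ g : Ω → ℝ, Measurable g → (∃ C : ℝ, ∀ ω, |g ω| ≤ C) → ∫ ω, g ω ∂μ = 0 →
      ∫ ω, h ω * g ω ∂μ = 0) :
    ∀ᵐ ω ∂μ, h ω = ∫ ω, h ω ∂μ := by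
  refine hh.ae_eq_of_forall_setIntegral_eq _ _ (integrable_const _) fun A hA _ => ?_
  have hAi : Integrable (A.indicator fun _ => (1 : ℝ)) μ := (integrable_const _).indicator hA
  have hb : ∀ ω, |A.indicator (fun _ => (1 : ℝ)) ω - μ.real A| ≤ 2 := fun ω => by
    have h1 : |A.indicator (fun _ => (1 : ℝ)) ω| ≤ 1 := by
      by_cases h : ω ∈ A <;> simp [h]
    have h2 : |μ.real A| ≤ 1 := by
      rw [abs_of_nonneg measureReal_nonneg]
      exact measureReal_le_one
    exact (abs_sub _ _).trans (by linarith)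
  have h0 : ∫ ω, (A.indicator (fun _ => (1 : ℝ)) ω - μ.real A) ∂μ = 0 := by
    rw [integral_sub hAi (integrable_const _), integral_indicator hA]
    simp
  have := H _ ((measurable_const.indicator hA).sub_const (μ.real A)) ⟨2, hb⟩ h0
  have e : ∀ ω, h ω * (A.indicator (fun _ => (1 : ℝ)) ω - μ.real A) =
      A.indicator h ω - h ω * μ.real A := fun ω => by
    by_cases hω : ω ∈ A
    · simp [hω]
      ring
    · simp [hω]
  simp only [e] at this
  rw [integral_sub (hh.indicator hA) (hh.mul_const _), integral_indicator hA,
    integral_mul_const] at this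
  rw [setIntegral_const, smul_eq_mul]
  linarith

variable {d : ℕ} {G : SimpleGraph (Fin d)} {P : ProbabilityMeasure (FullData d)}

/-- The tangent space of the model is the space of all mean-zero square-integrable functions of the
observed data. -/
theorem mem_tangentSpace_iff (hP : P ∈ model G) {φ : FullData d → ℝ}
    (hφ : MemLp φ 2 (obsLaw P)) :
    hφ.toLp φ ∈ tangentSpace (model G) P ↔ ∫ o, φ o ∂(obsLaw P) = 0 := by
  have hinner : ∀ u v : Lp ℝ 2 (obsLaw P),
      inner ℝ u v = ∫ o, v o * u o ∂(obsLaw P) := fun u v => by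
    rw [L2.inner_def]
    rfl
  rw [tangentSpace, ← Submodule.orthogonal_orthogonal_eq_closure, Submodule.mem_orthogonal]
  constructor
  · -- the constant `1` is orthogonal to all scores
    intro h
    have h1 : MemLp (fun _ : FullData d => (1 : ℝ)) 2 (obsLaw P) := memLp_const 1
    have := h (h1.toLp _) (by
      rw [Submodule.mem_orthogonal]
      intro u hu
      induction hu using Submodule.span_induction with
      | mem u hu =>
        obtain ⟨g, Q, hQ, hug⟩ := hu
        rw [hinner, ← hQ.score_mean]
        refine integral_congr_ae ?_
        filter_upwards [hug, h1.coeFn_toLp] with o ho1 ho2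
        rw [ho1, ho2, one_mul]
      | zero => simp
      | add u v _ _ hu hv => rw [inner_add_left, hu, hv, add_zero]
      | smul c u _ hu => rw [inner_smul_left, hu, mul_zero])
    rw [hinner] at this
    rw [← this]
    refine integral_congr_ae ?_
    filter_upwards [hφ.coeFn_toLp, h1.coeFn_toLp] with o ho1 ho2
    rw [ho1, ho2, mul_one]
  · -- a function orthogonal to all scores is constant
    intro h0 u hu
    rw [Submodule.mem_orthogonal] at hu
    have hui : Integrable u (obsLaw P) := (Lp.memLp u).integrable one_le_two
    have hc := ae_eq_integral_of_forall_integral_mul_eq_zero hui fun g hg ⟨C, hC⟩ hg0 => by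
      obtain ⟨Q, hQ⟩ := exists_isSubmodel hP hg hC hg0
      have hgL : MemLp g 2 (obsLaw P) := MemLp.of_bound hg.aestronglyMeasurable C (ae_of_all _ hC)
      have := hu (hgL.toLp g) (Submodule.subset_span ⟨g, Q, hQ, hgL.coeFn_toLp⟩)
      rw [hinner] at this
      rw [← this]
      refine integral_congr_ae ?_
      filter_upwards [hgL.coeFn_toLp] with o ho
      rw [ho]
    rw [hinner]
    have : (fun o => hφ.toLp φ o * u o) =ᵐ[obsLaw P] fun o => φ o * ∫ o, u o ∂(obsLaw P) := by
      filter_upwards [hφ.coeFn_toLp, hc] with o ho1 ho2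
      rw [ho1, ho2]
    rw [integral_congr_ae this, integral_mul_const, h0, zero_mul]

end Tangent

end MMG

theorem theorem5 {d : ℕ} (G : SimpleGraph (Fin d)) (a : Fin d) (s : Finset (Fin d))
    (has : a ∈ s) (hs : (G.induce (s : Set (Fin d))).Connected)
    (P : ProbabilityMeasure (MMG.FullData d)) (hP : P ∈ MMG.model G)
    (hint : Integrable (MMG.targetVar G a s) (P : Measure (MMG.FullData d))) :
    (∀ ω, MMG.eif G a s P (MMG.observe ω) = MMG.eif G a s P ω) ∧
    (Integrable (MMG.eif G a s P) (MMG.obsLaw P) ∧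
      ∫ o, MMG.eif G a s P o ∂(MMG.obsLaw P) = 0) ∧
    (∀ g Q, MMG.IsSubmodel (MMG.model G) P g Q →
      (∀ᶠ t in 𝓝 (0 : ℝ),
        Integrable (MMG.targetVar G a s) (Q t : Measure (MMG.FullData d))) ∧
      HasDerivAt (fun t => MMG.mu G a s (Q t))
        (∫ o, MMG.eif G a s P o * g o ∂(MMG.obsLaw P)) 0) ∧
    (∀ φ : MMG.FullData d → ℝ,
      MMG.IsEfficientInfluenceFunction (MMG.model G) (MMG.mu G a s) P φ ↔
        MemLp (MMG.eif G a s P) 2 (MMG.obsLaw P) ∧ φ =ᵐ[MMG.obsLaw P] MMG.eif G a s P) := by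
  obtain ⟨heif, heif0⟩ := MMG.integrable_eif has hP hint
  refine ⟨MMG.eif_observe has P, ⟨heif, heif0⟩,
    fun g Q hQ => MMG.submodel_hasDerivAt has hP hint hQ, fun φ => ⟨fun hφ => ?_, ?_⟩⟩
  · have hφi : Integrable φ (MMG.obsLaw P) := hφ.memLp.integrable one_le_two
    have hφ0 := (MMG.mem_tangentSpace_iff hP hφ.memLp).1 hφ.mem_tangentSpace
    -- the two gradients differ by a function that is orthogonal to all scores, hence constant
    have hc := MMG.ae_eq_integral_of_forall_integral_mul_eq_zero (hφi.sub heif)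
      fun g hg ⟨C, hC⟩ hg0 => by
        obtain ⟨Q, hQ⟩ := MMG.exists_isSubmodel hP hg hC hg0
        have := (hφ.hasDerivAt g Q hQ).unique (MMG.submodel_hasDerivAt has hP hint hQ).2
        simp only [Pi.sub_apply, sub_mul]
        rw [integral_sub (MMG.integrable_mul_of_abs_le hφi hg hC)
          (MMG.integrable_mul_of_abs_le heif hg hC), this, sub_self]
    have heq : φ =ᵐ[MMG.obsLaw P] MMG.eif G a s P := by
      rw [integral_sub' hφi heif, hφ0, heif0, sub_zero] at hc
      filter_upwards [hc] with o ho using sub_eq_zero.1 ho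
    exact ⟨hφ.memLp.ae_eq heq, heq⟩
  · rintro ⟨hL, heq⟩
    have hφ : MemLp φ 2 (MMG.obsLaw P) := hL.ae_eq heq.symm
    refine ⟨hφ, ?_, fun g Q hQ => ?_⟩
    · rw [MMG.mem_tangentSpace_iff hP, integral_congr_ae heq, heif0]
    · have e : ∫ o, φ o * g o ∂(MMG.obsLaw P) =
          ∫ o, MMG.eif G a s P o * g o ∂(MMG.obsLaw P) :=
        integral_congr_ae (heq.mul (EventuallyEq.refl _ g))
      rw [e]
      exact (MMG.submodel_hasDerivAt has hP hint hQ).2
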